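/- Let $C$ be an algebraically closed field, regarded as a subfield of the complex numbers. Let $C\{t\}$ be the ring of convergent power series with coefficients in $C$. Let $K$ be a finite Galois extension of $C(x)$ with Galois group $H$, so that $K$ is the function field of a curve $\mathbf C$ with a covering $\pi:\mathbf C\to\mathbf P^1=C\cup\{\infty\}$, where $\pi$ is given by the function $x$; the points of $\mathbf C$ below are points of the smooth projective model, given by their local rings, the valuation rings of $K$ that contain $C$ and are different from $K$. Let $G^0$ be a connected linear algebraic group over $C$ on which $H$ acts from the right by automorphisms of algebraic groups, written $g\mapsto h^{-1}gh$, and let $\mathcal G$ be the Lie algebra of $G^0$, a right $H$-module by the differentials of these automorphisms at the identity. For a $C$-algebra $L$ put $\mathcal G(L)=L\otimes_C\mathcal G$. An element $A\in\mathcal G(K)$ is *equivariant* if $hA=Ah$ for all $h\in H$, where $h(f\otimes v)=h(f)\otimes v$ and $(f\otimes v)h=f\otimes vh$. Call a set $\mathcal S\subset\mathbf P^1$ *exceptional* for $K$ if for every such $G^0$ the following holds. Given 1. integers $M\le N$, 2. points $p_1,\dots,p_r\in\mathbf C$ with $\pi(p_i)\notin\mathcal S$ and $\pi(p_i)\ne\pi(p_j)$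 for $i\ne j$, 3. a local parameter $t_i$ at each $p_i$, and 4. for each $i$ elements $A_{i,M},\dots,A_{i,N}\in\mathcal G(C)=\mathcal G$, there is an equivariant $A\in\mathcal G(K)$ such that for each $i$ the expansion of $A$ at $p_i$ in the local parameter $t=t_i$ is $$A=A_{i,M}t^M+\dots+A_{i,N}t^N+t^{N+1}B_i(t)\qquad\text{with } B_i(t)\in\mathcal G(C\{t\}).$$ Then every $K$ as above has a finite exceptional set $\mathcal S\subset\mathbf P^1$. Moreover, such a set can be computed: let $k\subset C$ be an algebraically closed subfield that is recursive, that is, its elements are coded by natural numbers in such a way that addition and multiplication are computable. Then there is an algorithm with the following property. If its input is a polynomial $F(x,y)$ with coefficients in $k$ such that $K=C(x)(y)$ for some $y\in K$ with $F(x,y)=0$, and such that the degree of $F$ in its second variable is $[K:C(x)]$, then it halts and its output is a finite list of points of $k\cup\{\infty\}\subset\mathbf P^1$ which form an exceptional set for $K$. -/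

import Mathlib

open scoped TensorProduct OnePoint

universe u v w

noncomputable section

namespace Covering

/-! ### Points of the curve, the covering map, local expansions -/

/-- The ring `C{t}` of convergent power series, where `C` is regarded as a subfield of the complex
numbers through `ι`: the power series whose image in `ℂ[[t]]` has a positive radius of
convergence. -/
def ConvergentSeries {C : Type u} [Field C] (ι : C →+* ℂ) : Subalgebra C (PowerSeries C) where
  carrier := {f | ∃ ρ : ℝ, 0 < ρ ∧ Summable fun n : ℕ => ‖ι (PowerSeries.coeff n f)‖ * ρ ^ n}
  mul_mem' := by
    rintro f g ⟨ρ, hρ, hf⟩ ⟨σ, hσ, hg⟩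
    have hτ : 0 < min ρ σ := lt_min hρ hσ
    have key : ∀ (h : PowerSeries C) (r : ℝ), min ρ σ ≤ r →
        (Summable fun n : ℕ => ‖ι (PowerSeries.coeff n h)‖ * r ^ n) →
        Summable fun n : ℕ => ‖ι (PowerSeries.coeff n h) * ((min ρ σ : ℝ) : ℂ) ^ n‖ := by
      intro h r hr hs
      refine Summable.of_nonneg_of_le (fun n => norm_nonneg _) (fun n => ?_) hs
      rw [norm_mul, norm_pow, Complex.norm_real, Real.norm_of_nonneg hτ.le]
      gcongr
    have := summable_norm_sum_mul_antidiagonal_of_summable_norm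
      (key f ρ (min_le_left _ _) hf) (key g σ (min_le_right _ _) hg)
    refine ⟨min ρ σ, hτ, this.congr fun n => ?_⟩
    rw [PowerSeries.coeff_mul, map_sum]
    rw [← Real.norm_of_nonneg (pow_nonneg hτ.le n), ← Complex.norm_real, ← norm_mul,
      Finset.sum_mul]
    refine congrArg _ (Finset.sum_congr rfl fun kl hkl => ?_)
    rw [← Finset.HasAntidiagonal.mem_antidiagonal.mp hkl, map_mul, Complex.ofReal_pow, pow_add]
    ring
  add_mem' := by
    rintro f g ⟨ρ, hρ, hf⟩ ⟨σ, hσ, hg⟩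
    have hτ : 0 < min ρ σ := lt_min hρ hσ
    refine ⟨min ρ σ, hτ, Summable.of_nonneg_of_le (fun n => by positivity) (fun n => ?_)
      (hf.add hg)⟩
    rw [map_add, map_add]
    calc ‖ι (PowerSeries.coeff n f) + ι (PowerSeries.coeff n g)‖ * (min ρ σ) ^ n
        ≤ (‖ι (PowerSeries.coeff n f)‖ + ‖ι (PowerSeries.coeff n g)‖) * (min ρ σ) ^ n := by
          gcongr
          exact norm_add_le _ _
      _ = ‖ι (PowerSeries.coeff n f)‖ * (min ρ σ) ^ n +
            ‖ι (PowerSeries.coeff n g)‖ * (min ρ σ) ^ n := by ring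
      _ ≤ ‖ι (PowerSeries.coeff n f)‖ * ρ ^ n + ‖ι (PowerSeries.coeff n g)‖ * σ ^ n := by
          gcongr
          · exact min_le_left _ _
          · exact min_le_right _ _
  algebraMap_mem' := by
    intro c
    refine ⟨1, one_pos, summable_of_ne_finset_zero (s := {0}) fun n hn => ?_⟩
    have hn' : n ≠ 0 := by simpa using hn
    have : PowerSeries.coeff n (algebraMap C (PowerSeries C) c) = 0 := by
      rw [show algebraMap C (PowerSeries C) c = PowerSeries.C c from rfl, PowerSeries.coeff_C,
        if_neg hn']
    rw [this, map_zero, norm_zero, zero_mul]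

/-- A point of the smooth projective curve over `C` with function field `K`, given by its local
ring: a valuation ring of `K` that contains the constants and is not `K`. -/
structure Point (C : Type u) (K : Type v) [Field C] [Field K] [Algebra C K] where
  /-- The local ring of the point. -/
  ring : ValuationSubring K
  const_mem : ∀ c : C, algebraMap C K c ∈ ring
  ne_top : ring ≠ ⊤

section

variable {C : Type u} {K : Type v} [Field C] [Field K] [Algebra (RatFunc C) K]

/-- The function `x` in `K`, a field extension of `C(x)`. -/
def x (C : Type u) (K : Type v) [Field C] [Field K] [Algebra (RatFunc C) K] : K :=
  algebraMap (RatFunc C) K RatFunc.X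

variable [Algebra C K]

open Classical in
/-- The covering map `π` to the projective line `C ∪ {∞}`: the value of the function `x` at the
point `p`, which is `a` if `x - a` vanishes at `p`, and `∞` if there is no such `a` in `C`. -/
def proj (p : Point C K) : OnePoint C :=
  if h : ∃ a : C, x C K - algebraMap C K a ∈ p.ring.nonunits then (h.choose : OnePoint C) else ∞

/-- `t` is a local parameter at `p`: it generates the maximal ideal of the local ring. -/
def IsLocalParameter (p : Point C K) (t : K) : Prop :=
  ∃ h : t ∈ p.ring, IsLocalRing.maximalIdeal p.ring = Ideal.span {⟨t, h⟩}

/-- `φ` is the expansion of functions at `p` into Laurent series in the local parameter `t`: the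
homomorphism of `C`-algebras `K → C((t))` that sends `t` to the variable and the functions that are
regular at `p` to power series. -/
structure IsLocalExpansion (p : Point C K) (t : K) (φ : K →ₗ[C] LaurentSeries C) : Prop where
  map_one : φ 1 = 1
  map_mul : ∀ f g : K, φ (f * g) = φ f * φ g
  map_parameter : φ t = HahnSeries.single 1 1
  map_regular : ∀ f ∈ p.ring, ∃ g : PowerSeries C, φ f = HahnSeries.ofPowerSeries ℤ C g

/-- The `C`-linear map `b ↦ t ^ n * b(t)` from `C{t}` to `C((t))`. -/
def powMul {C : Type u} [Field C] (ι : C →+* ℂ) (n : ℤ) :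
    ConvergentSeries ι →ₗ[C] LaurentSeries C where
  toFun b := HahnSeries.single n 1 * HahnSeries.ofPowerSeries ℤ C (b : PowerSeries C)
  map_add' a b := by
    rw [Subalgebra.coe_add, map_add, mul_add]
  map_smul' c b := by
    rw [Subalgebra.coe_smul, PowerSeries.smul_eq_C_mul, map_mul, HahnSeries.ofPowerSeries_C,
      RingHom.id_apply, mul_left_comm, HahnSeries.C_mul_eq_smul]

variable {V : Type w} [AddCommMonoid V] [Module C V]

/-- `A = A_M t ^ M + ⋯ + A_N t ^ N + t ^ (N + 1) * B(t)` at `p` for some `B ∈ V(C{t})`, where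
`V(L) = L ⊗ V`. The identity is one in `V(C((t)))`. -/
def HasExpansion (ι : C →+* ℂ) (p : Point C K) (t : K) (M N : ℤ) (coef : ℤ → V)
    (A : K ⊗[C] V) : Prop :=
  ∃ φ : K →ₗ[C] LaurentSeries C, IsLocalExpansion p t φ ∧
    ∃ B : ConvergentSeries ι ⊗[C] V,
      LinearMap.rTensor V φ A =
        ∑ k ∈ Finset.Icc M N, (HahnSeries.single k 1 : LaurentSeries C) ⊗ₜ[C] coef k +
          LinearMap.rTensor V (powMul ι (N + 1)) B

/-! ### Equivariant elements -/

variable [IsScalarTower C (RatFunc C) K]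

/-- Let `V` be a right module under `H = Gal(K/C(x))`, that is, a representation of the opposite
group. The element `A` of `V(K) = K ⊗ V` is equivariant if `h A = A h` for all `h` in `H`, where `h`
acts from the left on the factor `K` and from the right on the factor `V`. -/
def IsEquivariant (ρ : Representation C (K ≃ₐ[RatFunc C] K)ᵐᵒᵖ V) (A : K ⊗[C] V) : Prop :=
  ∀ h : K ≃ₐ[RatFunc C] K,
    LinearMap.rTensor V (h.restrictScalars C).toLinearMap A =
      LinearMap.lTensor K (ρ (MulOpposite.op h)) A

end

/-! ### The Lie algebra of a linear algebraic group and the action of `H` on it -/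

/-- The Lie algebra of the linear algebraic group with coordinate ring `R`, as a vector space: the
tangent space at the identity, that is, the space of derivations `R → C` at the identity (the value
of a function at the identity being the counit). -/
def LieAlg (C : Type u) (R : Type w) [Field C] [CommRing R] [HopfAlgebra C R] :
    Submodule C (R →ₗ[C] C) where
  carrier := {D | ∀ a b : R,
    D (a * b) = Coalgebra.counit (R := C) a * D b + Coalgebra.counit (R := C) b * D a}
  zero_mem' := by intro a b; simp
  add_mem' := by
    intro D E hD hE a b
    simp only [LinearMap.add_apply, hD a b, hE a b]
    ring
  smul_mem' := by
    intro c D hD a b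
    simp only [LinearMap.smul_apply, smul_eq_mul, hD a b]
    ring

/-- Let a group `H` act on a linear algebraic group from the right by automorphisms
`g ↦ h⁻¹ g h`; equivalently, `H` acts on the coordinate ring `R` from the left by automorphisms of
Hopf algebras, `(θ h f)(g) = f (h⁻¹ g h)`. The differentials of these automorphisms at the identity,
`D ↦ D ∘ θ h`, make the Lie algebra a right `H`-module. -/
def lieAction {C : Type u} {R : Type w} {H : Type v} [Field C] [CommRing R] [HopfAlgebra C R]
    [Group H] (θ : H →* (R →ₐc[C] R)) : Representation C Hᵐᵒᵖ (LieAlg C R) where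
  toFun h :=
    { toFun := fun D => ⟨D.1 ∘ₗ (θ h.unop : R →ₗ[C] R), by
        intro a b
        have hc : ∀ r : R, Coalgebra.counit (R := C) (θ h.unop r) = Coalgebra.counit (R := C) r :=
          fun r => CoalgHomClass.counit_comp_apply (θ h.unop) r
        have hD := D.2 (θ h.unop a) (θ h.unop b)
        rw [hc, hc, ← map_mul] at hD
        exact hD⟩
      map_add' := fun D E => rfl
      map_smul' := fun c D => rfl }
  map_one' := by
    ext D a
    simp
  map_mul' g h := by
    ext D a
    simp

/-! ### Exceptional sets and their computation -/

/-- The set `S` of points of the projective line is exceptional for the covering with function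
field `K`: for every connected linear algebraic group `G⁰` (with coordinate ring `R`) on which
`H = Gal(K/C(x))` acts by automorphisms, arbitrary coefficients of `t ^ M`, …, `t ^ N` in the Lie
algebra of `G⁰` can be prescribed, for an equivariant element, at finitely many points with distinct
projections outside `S`. -/
def IsExceptionalSet {C : Type u} [Field C] (ι : C →+* ℂ) (K : Type v) [Field K]
    [Algebra (RatFunc C) K] [Algebra C K] [IsScalarTower C (RatFunc C) K]
    (S : Set (OnePoint C)) : Prop :=
  ∀ (R : Type w) [CommRing R] [HopfAlgebra C R] [Algebra.FiniteType C R]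
    [ConnectedSpace (PrimeSpectrum R)] (θ : (K ≃ₐ[RatFunc C] K) →* (R →ₐc[C] R))
    (M N : ℤ), M ≤ N →
    ∀ (r : ℕ) (p : Fin r → Point C K),
      (∀ i, proj (p i) ∉ S) → (∀ i j, i ≠ j → proj (p i) ≠ proj (p j)) →
    ∀ t : Fin r → K, (∀ i, IsLocalParameter (p i) (t i)) →
    ∀ coef : Fin r → ℤ → LieAlg C R,
      ∃ A : K ⊗[C] LieAlg C R, IsEquivariant (lieAction θ) A ∧
        ∀ i, HasExpansion ι (p i) (t i) M N (coef i) A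

open Polynomial in
/-- The polynomial with a given list of coefficients, the constant term first. -/
def ofCoeffs {R : Type*} [CommRing R] (l : List R) : R[X] :=
  l.foldr (fun a q => C a + X * q) 0

/-- The polynomial in `k[x][y]` with a given list of lists of coefficients. -/
def ofCoeffs₂ {k : Type*} [Field k] (l : List (List k)) : Polynomial (Polynomial k) :=
  ofCoeffs (l.map ofCoeffs)

/-- `F(x, y) = 0` is an equation of the covering, with coefficients in the subfield `k` of `C`:
there is a generator `y` of `K` over `C(x)` with `F(x, y) = 0`, and the degree of `F` in its second
variable is `[K : C(x)]`. -/
def IsEquation {k C K : Type*} [Field k] [Field C] [Field K] [Algebra k C]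
    [Algebra (RatFunc C) K] [Algebra C K] (F : Polynomial (Polynomial k)) : Prop :=
  ∃ y : K, IntermediateField.adjoin (RatFunc C) {y} = ⊤ ∧
    F.eval₂ (Polynomial.eval₂RingHom ((algebraMap C K).comp (algebraMap k C)) (x C K)) y = 0 ∧
    F.natDegree = Module.finrank (RatFunc C) K

/-- The point of `C ∪ {∞}` given by an element of `k ∪ {∞}`, where `k` is a subfield of `C`. -/
def toLine {k C : Type*} [Field k] [Field C] [Algebra k C] : Option k → OnePoint C
  | none => ∞
  | some a => (algebraMap k C a : OnePoint C)

end Covering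

end

/-!
Equivariant elements are made by averaging: for `f ∈ K` and a vector `v`, the sum over `h ∈ H` of
`h(f) ⊗ v h⁻¹` is equivariant (`isEquivariant_sum_map`). Its expansion at a point `p` involves `f`
at `p`, but also the expansions at `p` of the other conjugates `h(f)`, that is, of `f` at the other
points of the orbit of `p`. If the stabilizer of `p` is trivial, these are different points, and by
weak approximation `f` may be taken with a given expansion at `p`, up to any order, and with zeros of
high order at the other points. So the fibres over which `H` does not act freely, together with infinity, form an
exceptional set. The construction works for every vector space on which `H` acts, in particular for
the Lie algebra of `G⁰`.

Weak approximation is explicit here. Suppose that a generator `y` of `K` is regular along the fibres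
of all given points, and that its conjugates have different values there (`SeparatesFibre`). Then
Lagrange interpolation in `y` and `x` gives a function with value `1` at a given point and `0` at
the other points of the fibres (`exists_interpolation`), and `1 - (1 - E ^ L) ^ L` improves the
approximation to order `L` (`exists_approximation`).

Local expansions exist because the local ring of a point is a discrete valuation ring with residue
field `C` (`exists_valuation_sub_lt`, `exists_pow_valuation_le`), both consequences of the fact that
any two functions are algebraically dependent. For the same reason an expansion is algebraic over
`C[t]`, and algebraic power series converge: a simple root satisfies, after subtraction of a
truncation, a fixed point equation `u = q + X Φ(X, u)`, whose truncations are bounded recursively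
(`summable_of_eq_add_X_mul`).

The function `y` separates the fibre over `a` if `D(a) ≠ 0`, where `D ∈ k[x]` is a combination of
`F` and `∂F/∂y`, and the coefficient of the highest power of `y` in a multiple of `F`
(`ControlsFibres.separatesFibre`). Over an algebraically closed field there is such a `D` that is a
product of linear factors (`IsEquation.exists_controlsFibres`). The identities that show this for a
given list of zeros are decidable by computable polynomial arithmetic (`RingPresentation.list`), so
an unbounded search finds such a list (`RingPresentation.exists_mem_search`). The same polynomials,
with `k = C`, give the finite exceptional set in the first part.
-/

noncomputable section

/-! ### Algebraic power series are convergent -/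

open Polynomial in
/-- The evaluation at `(X, g)` of a polynomial in two variables, where `g` is a power series. -/
abbrev evalSeries {F : Type*} [Field F] (g : PowerSeries F) : Polynomial F[X] →+* PowerSeries F :=
  eval₂RingHom (coeToPowerSeries.ringHom (R := F)) g

/-- The norm of the polynomial of degree at most `n` that truncates `f`, in the Banach algebra of
power series that converge absolutely at the radius `ρ`. -/
def truncNorm (ρ : ℝ) (n : ℕ) (f : PowerSeries ℂ) : ℝ :=
  ∑ k ∈ Finset.range (n + 1), ‖PowerSeries.coeff k f‖ * ρ ^ k

section

variable {ρ : ℝ}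

theorem truncNorm_nonneg (hρ : 0 ≤ ρ) (n : ℕ) (f : PowerSeries ℂ) : 0 ≤ truncNorm ρ n f :=
  Finset.sum_nonneg fun _ _ => by positivity

theorem truncNorm_add_le (hρ : 0 ≤ ρ) (n : ℕ) (f g : PowerSeries ℂ) :
    truncNorm ρ n (f + g) ≤ truncNorm ρ n f + truncNorm ρ n g := by
  rw [truncNorm, truncNorm, truncNorm, ← Finset.sum_add_distrib]
  refine Finset.sum_le_sum fun k _ => ?_
  rw [map_add, ← add_mul]
  gcongr
  exact norm_add_le _ _

theorem truncNorm_mul_le (hρ : 0 ≤ ρ) (n : ℕ) (f g : PowerSeries ℂ) :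
    truncNorm ρ n (f * g) ≤ truncNorm ρ n f * truncNorm ρ n g := by
  have h1 : truncNorm ρ n (f * g) ≤ ∑ k ∈ Finset.range (n + 1),
      ∑ ij ∈ Finset.HasAntidiagonal.antidiagonal k,
        (‖PowerSeries.coeff ij.1 f‖ * ρ ^ ij.1) * (‖PowerSeries.coeff ij.2 g‖ * ρ ^ ij.2) := by
    refine Finset.sum_le_sum fun k _ => ?_
    rw [PowerSeries.coeff_mul]
    refine (mul_le_mul_of_nonneg_right (norm_sum_le _ _) (by positivity)).trans_eq ?_
    rw [Finset.sum_mul]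
    refine Finset.sum_congr rfl fun ij hij => ?_
    rw [← Finset.HasAntidiagonal.mem_antidiagonal.mp hij, norm_mul, pow_add]
    ring
  refine h1.trans ?_
  rw [truncNorm, truncNorm, Finset.sum_mul_sum, ← Finset.sum_product', Finset.sum_sigma']
  rw [← Finset.sum_image (s := (Finset.range (n + 1)).sigma fun k =>
    Finset.HasAntidiagonal.antidiagonal k) (g := fun a => a.2)
    (f := fun ij : ℕ × ℕ => (‖PowerSeries.coeff ij.1 f‖ * ρ ^ ij.1) *
      (‖PowerSeries.coeff ij.2 g‖ * ρ ^ ij.2))]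
  · refine Finset.sum_le_sum_of_subset_of_nonneg (fun ij hij => ?_) fun ij _ _ => by positivity
    simp only [Finset.mem_image, Finset.mem_sigma, Finset.mem_range,
      Finset.HasAntidiagonal.mem_antidiagonal, Sigma.exists, Finset.mem_product] at hij ⊢
    obtain ⟨k, b, ⟨hk, hb⟩, rfl⟩ := hij
    omega
  · rintro ⟨k, ij⟩ h ⟨l, ij'⟩ h' rfl
    simp only [Finset.coe_sigma, Set.mem_sigma_iff, Finset.mem_coe,
      Finset.HasAntidiagonal.mem_antidiagonal] at h h'
    obtain rfl : k = l := h.2.symm.trans h'.2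
    rfl

theorem truncNorm_X_mul (n : ℕ) (f : PowerSeries ℂ) :
    truncNorm ρ (n + 1) (PowerSeries.X * f) = ρ * truncNorm ρ n f := by
  rw [truncNorm, Finset.sum_range_succ', truncNorm, Finset.mul_sum]
  simp only [PowerSeries.coeff_succ_X_mul, PowerSeries.coeff_zero_X_mul, norm_zero, zero_mul,
    add_zero]
  refine Finset.sum_congr rfl fun k _ => ?_
  ring

theorem truncNorm_zero_add_X_mul (f g : PowerSeries ℂ) :
    truncNorm ρ 0 (f + PowerSeries.X * g) = truncNorm ρ 0 f := by
  simp [truncNorm]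

end

/-- A polynomial with polynomial coefficients is bounded on bounded sets, uniformly in the radius
and in the order of truncation. -/
theorem exists_truncNorm_evalSeries_le (Φ : Polynomial (Polynomial ℂ)) {B : ℝ} (hB : 0 ≤ B) :
    ∃ M : ℝ, 0 ≤ M ∧ ∀ (ρ : ℝ) (n : ℕ) (g : PowerSeries ℂ), 0 ≤ ρ → ρ ≤ 1 →
      truncNorm ρ n g ≤ B → truncNorm ρ n (evalSeries g Φ) ≤ M := by
  have hX : ∀ (ρ : ℝ) (n : ℕ), 0 ≤ ρ → ρ ≤ 1 → truncNorm ρ n PowerSeries.X ≤ 1 := by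
    intro ρ n h0 h1
    cases n with
    | zero => simp [truncNorm]
    | succ n =>
      rw [← mul_one PowerSeries.X, truncNorm_X_mul]
      have : truncNorm ρ n 1 ≤ 1 := by
        simp only [truncNorm, PowerSeries.coeff_one]
        rw [Finset.sum_eq_single 0] <;> simp +contextual
      nlinarith [truncNorm_nonneg h0 n 1]
  have hC : ∀ (c : ℂ) (ρ : ℝ) (n : ℕ), truncNorm ρ n (PowerSeries.C c) ≤ ‖c‖ := by
    intro c ρ n
    simp only [truncNorm, PowerSeries.coeff_C]
    rw [Finset.sum_eq_single 0] <;> simp +contextual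
  have hp : ∀ p : Polynomial ℂ, ∃ M : ℝ, 0 ≤ M ∧ ∀ (ρ : ℝ) (n : ℕ), 0 ≤ ρ → ρ ≤ 1 →
      truncNorm ρ n (p : PowerSeries ℂ) ≤ M := by
    intro p
    induction p using Polynomial.induction_on with
    | C c => exact ⟨‖c‖, norm_nonneg _, fun ρ n _ _ => by rw [Polynomial.coe_C]; exact hC c ρ n⟩
    | add p q hp hq =>
      obtain ⟨M, hM, hp⟩ := hp
      obtain ⟨N, hN, hq⟩ := hq
      refine ⟨M + N, by positivity, fun ρ n h0 h1 => ?_⟩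
      rw [Polynomial.coe_add]
      exact (truncNorm_add_le h0 n _ _).trans (add_le_add (hp ρ n h0 h1) (hq ρ n h0 h1))
    | monomial k c h =>
      obtain ⟨M, hM, h⟩ := h
      refine ⟨M * 1, by positivity, fun ρ n h0 h1 => ?_⟩
      rw [pow_succ, ← mul_assoc, Polynomial.coe_mul, Polynomial.coe_X]
      exact (truncNorm_mul_le h0 n _ _).trans
        (mul_le_mul (h ρ n h0 h1) (hX ρ n h0 h1) (truncNorm_nonneg h0 _ _) hM)
  induction Φ using Polynomial.induction_on with
  | C p =>
    obtain ⟨M, hM, h⟩ := hp p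
    exact ⟨M, hM, fun ρ n g h0 h1 _ => by simpa using h ρ n h0 h1⟩
  | add p q hp hq =>
    obtain ⟨M, hM, hp⟩ := hp
    obtain ⟨N, hN, hq⟩ := hq
    refine ⟨M + N, by positivity, fun ρ n g h0 h1 hg => ?_⟩
    rw [map_add]
    exact (truncNorm_add_le h0 n _ _).trans (add_le_add (hp ρ n g h0 h1 hg) (hq ρ n g h0 h1 hg))
  | monomial k c h =>
    obtain ⟨M, hM, h⟩ := h
    refine ⟨M * B, by positivity, fun ρ n g h0 h1 hg => ?_⟩
    rw [pow_succ, ← mul_assoc, map_mul, Polynomial.coe_eval₂RingHom, Polynomial.eval₂_X]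
    exact (truncNorm_mul_le h0 n _ _).trans
      (mul_le_mul (h ρ n g h0 h1 hg) hg (truncNorm_nonneg h0 _ _) hM)

/-- A power series `u` is convergent if it solves a fixed point equation `u = q + X Φ(X, u)`. The
truncations of `u` are bounded by recursion, with a bound on `q` plus one, once the radius is so
small that it compensates the growth of `Φ` on the ball of this radius. -/
theorem summable_of_eq_add_X_mul {u : PowerSeries ℂ} {q : Polynomial ℂ}
    {Φ : Polynomial (Polynomial ℂ)} (h : u = (q : PowerSeries ℂ) + PowerSeries.X * evalSeries u Φ) :
    ∃ ρ : ℝ, 0 < ρ ∧ Summable fun n : ℕ => ‖PowerSeries.coeff n u‖ * ρ ^ n := by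
  obtain ⟨K, hK, hq⟩ := exists_truncNorm_evalSeries_le (Polynomial.C q) (B := 0) le_rfl
  replace hq : ∀ ρ n, 0 ≤ ρ → ρ ≤ 1 → truncNorm ρ n (q : PowerSeries ℂ) ≤ K := by
    intro ρ n h0 h1
    simpa using hq ρ n 0 h0 h1 (by simp [truncNorm])
  obtain ⟨M, hM, hΦ⟩ := exists_truncNorm_evalSeries_le Φ (B := K + 1) (by positivity)
  have hρ : (0 : ℝ) < (1 + M)⁻¹ := by positivity
  have hρ1 : (1 + M)⁻¹ ≤ 1 := inv_le_one_of_one_le₀ (by linarith)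
  have key : ∀ n, truncNorm (1 + M)⁻¹ n u ≤ K + 1 := by
    intro n
    induction n with
    | zero =>
      rw [congrArg (truncNorm _ 0) h, truncNorm_zero_add_X_mul]
      exact (hq _ _ hρ.le hρ1).trans (by linarith)
    | succ n ih =>
      rw [congrArg (truncNorm _ (n + 1)) h]
      refine (truncNorm_add_le hρ.le _ _ _).trans (add_le_add (hq _ _ hρ.le hρ1) ?_)
      rw [truncNorm_X_mul]
      calc (1 + M)⁻¹ * truncNorm (1 + M)⁻¹ n (evalSeries u Φ) ≤ (1 + M)⁻¹ * (1 + M) := by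
            gcongr
            exact (hΦ _ n u hρ.le hρ1 ih).trans (by linarith)
        _ = 1 := inv_mul_cancel₀ (by positivity)
  refine ⟨_, hρ, summable_of_sum_range_le (c := K + 1) (fun n => by positivity) fun n => ?_⟩
  refine le_trans ?_ (key n)
  rw [truncNorm, Finset.sum_range_succ]
  exact le_add_of_nonneg_right (by positivity)

/-- Newton's lemma: a simple root of a polynomial over `ℂ[X]` is convergent, since the remainder of
a sufficiently long truncation of the root solves a fixed point equation. -/
theorem summable_of_simple_root {g : PowerSeries ℂ} {P : Polynomial (Polynomial ℂ)}
    (h : evalSeries g P = 0) (h' : evalSeries g P.derivative ≠ 0) :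
    ∃ ρ : ℝ, 0 < ρ ∧ Summable fun n : ℕ => ‖PowerSeries.coeff n g‖ * ρ ^ n := by
  classical
  set κ := Polynomial.coeToPowerSeries.ringHom (R := ℂ) with hκ
  have hκX : κ Polynomial.X = PowerSeries.X := Polynomial.coe_X
  have hex : ∃ m, PowerSeries.coeff m (evalSeries g P.derivative) ≠ 0 := by
    by_contra! hc
    exact h' (PowerSeries.ext (by simpa using hc))
  obtain ⟨m, hm, hmin⟩ : ∃ m, PowerSeries.coeff m (evalSeries g P.derivative) ≠ 0 ∧
      ∀ i < m, PowerSeries.coeff i (evalSeries g P.derivative) = 0 :=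
    ⟨Nat.find hex, Nat.find_spec hex, fun i hi => not_not.mp (Nat.find_min hex hi)⟩
  set s := PowerSeries.trunc (m + 1) g with hs
  obtain ⟨u, hu⟩ : PowerSeries.X ^ (m + 1) ∣ g - κ s := by
    rw [PowerSeries.X_pow_dvd_iff]
    intro i hi
    simp [hκ, hs, PowerSeries.coeff_trunc, hi]
  have hg : g = κ s + PowerSeries.X ^ (m + 1) * u := by rw [← hu]; ring
  have hev : ∀ Q : Polynomial (Polynomial ℂ), κ (Q.eval s) = evalSeries (κ s) Q := by
    exact fun Q => (Polynomial.eval₂_at_apply κ s).symm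
  have hcong : ∀ i ≤ m, PowerSeries.coeff i (κ (P.derivative.eval s)) =
      PowerSeries.coeff i (evalSeries g P.derivative) := by
    have hd : PowerSeries.X ^ (m + 1) ∣ evalSeries g P.derivative - κ (P.derivative.eval s) := by
      rw [hev]
      refine (Dvd.intro _ hu.symm).trans ?_
      simp only [Polynomial.coe_eval₂RingHom, Polynomial.eval₂_eq_eval_map]
      exact Polynomial.sub_dvd_eval_sub _ _ _
    intro i hi
    have := PowerSeries.X_pow_dvd_iff.mp hd i (by omega)
    rw [map_sub, sub_eq_zero] at this
    exact this.symm
  obtain ⟨w, hw⟩ : Polynomial.X ^ m ∣ P.derivative.eval s := by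
    rw [Polynomial.X_pow_dvd_iff]
    intro i hi
    have := hcong i hi.le
    rw [hmin i hi] at this
    simpa [hκ] using this
  have hw0 : w.coeff 0 ≠ 0 := by
    have := hcong m le_rfl
    rw [hw] at this
    intro h0
    apply hm
    rw [← this]
    simp [hκ, PowerSeries.coeff_X_pow_mul', h0]
  obtain ⟨k, hk⟩ := Polynomial.binomExpansion (P.map Polynomial.C) (Polynomial.C s)
    (Polynomial.C (Polynomial.X ^ (m + 1)) * Polynomial.X)
  have hkey : 0 = κ (P.eval s) + κ (P.derivative.eval s) * (PowerSeries.X ^ (m + 1) * u) +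
      evalSeries u k * (PowerSeries.X ^ (m + 1) * u) ^ 2 := by
    have hC : (evalSeries u).comp Polynomial.C = κ := RingHom.ext fun a => by simp [hκ]
    have hmap : ∀ (Q : Polynomial (Polynomial ℂ)) (z : Polynomial (Polynomial ℂ)),
        evalSeries u ((Q.map Polynomial.C).eval z) = evalSeries (evalSeries u z) Q := by
      intro Q z
      rw [Polynomial.eval_map, Polynomial.hom_eval₂, hC]
      rfl
    have hCs : evalSeries u (Polynomial.C s) = κ s := congrArg (fun f => f s) hC
    have hCX : evalSeries u (Polynomial.C (Polynomial.X ^ (m + 1)) * Polynomial.X) =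
        PowerSeries.X ^ (m + 1) * u := by
      rw [map_mul, show evalSeries u (Polynomial.C (Polynomial.X ^ (m + 1))) = _ from
        congrArg (fun f => f ((Polynomial.X : Polynomial ℂ) ^ (m + 1))) hC, map_pow, hκX,
        Polynomial.coe_eval₂RingHom, Polynomial.eval₂_X]
    generalize (Polynomial.C (Polynomial.X ^ (m + 1)) * Polynomial.X :
      Polynomial (Polynomial ℂ)) = b at hk hCX
    have := congrArg (evalSeries u) hk
    rw [map_add, map_add, map_mul, map_mul, map_pow, Polynomial.derivative_map, hmap, hmap, hmap,
      map_add, hCs, hCX, ← hg, h, ← hev, ← hev] at this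
    exact this
  have hw' : κ (P.derivative.eval s) = PowerSeries.X ^ m * κ w := by
    rw [hw, map_mul, map_pow, hκX]
  obtain ⟨q, hq⟩ : Polynomial.X ^ (2 * m + 1) ∣ P.eval s := by
    have hd : PowerSeries.X ^ (2 * m + 1) ∣ κ (P.eval s) := by
      refine ⟨-(κ w * u + PowerSeries.X * (evalSeries u k * u ^ 2)), ?_⟩
      rw [hw'] at hkey
      linear_combination -hkey
    rw [Polynomial.X_pow_dvd_iff]
    intro i hi
    simpa [hκ] using PowerSeries.X_pow_dvd_iff.mp hd i hi
  have hmain : κ q + κ w * u + PowerSeries.X * (evalSeries u k * u ^ 2) = 0 := by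
    have hX : (PowerSeries.X : PowerSeries ℂ) ^ (2 * m + 1) ≠ 0 :=
      pow_ne_zero _ PowerSeries.X_ne_zero
    refine (mul_eq_zero.mp ?_).resolve_left hX
    rw [hw', hq, map_mul, map_pow, hκX] at hkey
    linear_combination -hkey
  have hwX : κ w = PowerSeries.X * κ w.divX + PowerSeries.C (w.coeff 0) := by
    conv_lhs => rw [← Polynomial.X_mul_divX_add w]
    rw [map_add, map_mul, hκX]
    simp [hκ]
  -- the equation for `u`, solved for the term with the invertible coefficient `w(0)`
  obtain ⟨ρ, hρ, hsum⟩ := summable_of_eq_add_X_mul (u := u)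
    (q := Polynomial.C (-(w.coeff 0)⁻¹) * q)
    (Φ := Polynomial.C (Polynomial.C (-(w.coeff 0)⁻¹)) *
      (Polynomial.C w.divX * Polynomial.X + k * Polynomial.X ^ 2)) (by
    have hc : PowerSeries.C (w.coeff 0)⁻¹ * PowerSeries.C (w.coeff 0) = 1 := by
      rw [← map_mul, inv_mul_cancel₀ hw0, map_one]
    have h1 : ((Polynomial.C (-(w.coeff 0)⁻¹) * q : Polynomial ℂ) : PowerSeries ℂ) =
        -PowerSeries.C (w.coeff 0)⁻¹ * κ q := by simp [hκ]
    have h2 : evalSeries u (Polynomial.C (Polynomial.C (-(w.coeff 0)⁻¹)) *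
      (Polynomial.C w.divX * Polynomial.X + k * Polynomial.X ^ 2)) =
        -PowerSeries.C (w.coeff 0)⁻¹ * (κ w.divX * u + evalSeries u k * u ^ 2) := by simp [hκ]
    rw [h1, h2]
    rw [hwX] at hmain
    linear_combination -u * hc + PowerSeries.C (w.coeff 0)⁻¹ * hmain)
  refine ⟨ρ, hρ, ?_⟩
  rw [← summable_nat_add_iff (m + 1)]
  refine (hsum.mul_right (ρ ^ (m + 1))).congr fun n => ?_
  have hcoef : PowerSeries.coeff (n + (m + 1)) g = PowerSeries.coeff n u := by
    have h0 : PowerSeries.coeff (n + (m + 1)) (κ s) = 0 := by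
      simp only [hκ, s, Polynomial.coeToPowerSeries.ringHom_apply, Polynomial.coeff_coe,
        PowerSeries.coeff_trunc]
      exact if_neg (by omega)
    rw [congrArg (PowerSeries.coeff (n + (m + 1))) hg, map_add, PowerSeries.coeff_X_pow_mul, h0,
      zero_add]
  rw [hcoef, pow_add _ n, mul_assoc]

/-- A power series over `ℂ` that is algebraic over `ℂ[X]` is convergent. -/
theorem summable_of_algebraic {g : PowerSeries ℂ} {P : Polynomial (Polynomial ℂ)} (hP : P ≠ 0)
    (h : evalSeries g P = 0) :
    ∃ ρ : ℝ, 0 < ρ ∧ Summable fun n : ℕ => ‖PowerSeries.coeff n g‖ * ρ ^ n := by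
  induction hn : P.natDegree using Nat.strong_induction_on generalizing P with
  | _ n ih =>
    by_cases h' : evalSeries g P.derivative = 0
    · by_cases h0 : P.natDegree = 0
      · rw [Polynomial.eq_C_of_natDegree_eq_zero h0] at h hP
        simp only [Polynomial.coe_eval₂RingHom, Polynomial.eval₂_C,
          Polynomial.coeToPowerSeries.ringHom_apply, Polynomial.coe_eq_zero_iff] at h
        simp [h] at hP
      · refine ih _ ?_ (fun hd => h0 ?_) h' rfl
        · rw [← hn]
          exact Polynomial.natDegree_derivative_lt h0
        · exact Polynomial.derivative_eq_zero.mp hd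
    · exact summable_of_simple_root h h'

open Covering in
/-- Convergence of algebraic power series with coefficients in a subfield of `ℂ`. -/
theorem mem_convergentSeries_of_algebraic {C : Type u} [Field C] (ι : C →+* ℂ) {g : PowerSeries C}
    {P : Polynomial (Polynomial C)} (hP : P ≠ 0) (h : evalSeries g P = 0) :
    g ∈ ConvergentSeries ι := by
  have := summable_of_algebraic (g := PowerSeries.map ι g)
    (P := P.map (Polynomial.mapRingHom ι)) ?_ ?_
  · simp only [PowerSeries.coeff_map] at this
    exact this
  · rwa [Ne, Polynomial.map_eq_zero_iff (Polynomial.map_injective ι ι.injective)]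
  · have := congrArg (PowerSeries.map ι) h
    rw [Polynomial.coe_eval₂RingHom, Polynomial.hom_eval₂, map_zero] at this
    rw [Polynomial.coe_eval₂RingHom, Polynomial.eval₂_map, ← this]
    congr 1
    ext <;> simp

/-! ### Points of a curve: values and rank one -/

section

variable {C : Type u} {K : Type v} [Field C] [Field K] [Algebra (RatFunc C) K] [Algebra C K]
  [IsScalarTower C (RatFunc C) K] [FiniteDimensional (RatFunc C) K]

open Polynomial in
/-- The function field of a curve has transcendence degree one: any two functions satisfy an
algebraic relation. -/
theorem exists_polynomial_relation (s f : K) :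
    ∃ P : C[X][X], P ≠ 0 ∧ P.eval₂ (eval₂RingHom (algebraMap C K) s) f = 0 := by
  by_cases hs : IsAlgebraic C s
  · obtain ⟨p, hp, hps⟩ := hs
    exact ⟨Polynomial.C p, by simpa using hp, by simpa [aeval_def] using hps⟩
  have hx : IsTranscendenceBasis C fun _ : Unit => Covering.x C K := by
    have := IsLocalization.isAlgebraic (RatFunc C) (nonZeroDivisors C[X])
    have h1 : IsTranscendenceBasis C fun _ : Unit => (RatFunc.X : RatFunc C) := by
      have := (IsTranscendenceBasis.polynomial Unit C).algebraMap_comp (A := RatFunc C)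
      simpa [Function.comp_def] using this
    exact h1.algebraMap_comp (A := K)
  have hs' : IsTranscendenceBasis C fun _ : Unit => s := by
    refine AlgebraicIndependent.isTranscendenceBasis_of_lift_trdeg_le_of_finite
      (algebraicIndependent_unique_type_iff.mpr hs) ?_
    rw [← hx.lift_cardinalMk_eq_trdeg]
  have := hs'.isAlgebraic
  obtain ⟨q, hq, hqf⟩ := this.isAlgebraic f
  have hsurj : Function.Surjective
      ((aeval s : C[X] →ₐ[C] K).codRestrict (Algebra.adjoin C (Set.range fun _ : Unit => s))
        fun p => by simp) := by
    rintro ⟨z, hz⟩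
    have hz' : z ∈ Algebra.adjoin C {s} := by simpa using hz
    rw [Algebra.adjoin_singleton_eq_range_aeval] at hz'
    obtain ⟨p, rfl⟩ := hz'
    exact ⟨p, rfl⟩
  obtain ⟨P, rfl⟩ := Polynomial.map_surjective
    ((aeval s : C[X] →ₐ[C] K).codRestrict (Algebra.adjoin C (Set.range fun _ : Unit => s))
        fun p => by simp).toRingHom hsurj q
  refine ⟨P, fun h => hq (by rw [h, Polynomial.map_zero]), ?_⟩
  rw [aeval_def, eval₂_map] at hqf
  exact hqf

end

namespace Covering.Point

open Polynomial

variable {C : Type u} {K : Type v} [Field C] [Field K] [Algebra C K] (p : Point C K)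

theorem valuation_algebraMap {c : C} (hc : c ≠ 0) : p.ring.valuation (algebraMap C K c) = 1 := by
  have h1 := (p.ring.valuation_le_one_iff _).mpr (p.const_mem c)
  have h2 := (p.ring.valuation_le_one_iff _).mpr (p.const_mem c⁻¹)
  rw [map_inv₀, map_inv₀] at h2
  refine le_antisymm h1 ((inv_le_one₀ ?_).mp h2)
  exact zero_lt_iff.mpr (by simpa using hc)

theorem valuation_algebraMap_le (c : C) : p.ring.valuation (algebraMap C K c) ≤ 1 :=
  (p.ring.valuation_le_one_iff _).mpr (p.const_mem c)

theorem valuation_aeval_le_one {s : K} (hs : p.ring.valuation s ≤ 1) (a : C[X]) :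
    p.ring.valuation (aeval s a) ≤ 1 := by
  rw [aeval_eq_sum_range]
  refine Valuation.map_sum_le _ fun i _ => ?_
  rw [Algebra.smul_def, map_mul, map_pow]
  exact mul_le_one' (p.valuation_algebraMap_le _) (pow_le_one' hs i)

theorem valuation_aeval_sub_le {s : K} (hs : p.ring.valuation s ≤ 1) (a : C[X]) :
    p.ring.valuation (aeval s a - algebraMap C K (a.coeff 0)) ≤ p.ring.valuation s := by
  have h : aeval s a - algebraMap C K (a.coeff 0) = s * aeval s a.divX := by
    have := congrArg (aeval s) (X_mul_divX_add a)
    rw [map_add, map_mul, aeval_X, aeval_C] at this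
    linear_combination -this
  rw [h, map_mul]
  exact mul_le_of_le_one_right' (p.valuation_aeval_le_one hs _)

theorem valuation_aeval_eq_one {s : K} (hs : p.ring.valuation s < 1) {a : C[X]}
    (ha : a.coeff 0 ≠ 0) : p.ring.valuation (aeval s a) = 1 := by
  have h := (p.valuation_aeval_sub_le hs.le a).trans_lt hs
  rw [← p.valuation_algebraMap ha] at h ⊢
  exact Valuation.map_eq_of_sub_lt _ h

theorem exists_valuation_aeval {s : K} (hs : p.ring.valuation s < 1) {a : C[X]} (ha : a ≠ 0) :
    ∃ m : ℕ, X ^ m ∣ a ∧ p.ring.valuation (aeval s a) = p.ring.valuation s ^ m := by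
  obtain ⟨b, hb, hd⟩ := (FiniteMultiplicity.of_not_isUnit (not_isUnit_X (R := C))
    ha).exists_eq_pow_mul_and_not_dvd
  refine ⟨_, Dvd.intro _ hb.symm, ?_⟩
  rw [X_dvd_iff] at hd
  conv_lhs => rw [hb]
  rw [map_mul, map_pow, aeval_X, map_mul, map_pow, p.valuation_aeval_eq_one hs hd, mul_one]

theorem valuation_eval₂_le_one {s f : K} (hs : p.ring.valuation s ≤ 1)
    (hf : p.ring.valuation f ≤ 1) (P : C[X][X]) :
    p.ring.valuation (P.eval₂ (eval₂RingHom (algebraMap C K) s) f) ≤ 1 := by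
  rw [eval₂_eq_sum_range]
  refine Valuation.map_sum_le _ fun i _ => ?_
  rw [map_mul, map_pow]
  exact mul_le_one' (p.valuation_aeval_le_one hs _) (pow_le_one' hf i)

theorem valuation_eval₂_sub_le {s f : K} (hs : p.ring.valuation s ≤ 1)
    (hf : p.ring.valuation f ≤ 1) (P : C[X][X]) :
    p.ring.valuation (P.eval₂ (eval₂RingHom (algebraMap C K) s) f -
      aeval f (P.map constantCoeff)) ≤ p.ring.valuation s := by
  rw [aeval_def, eval₂_map, eval₂_eq_sum_range, eval₂_eq_sum_range, ← Finset.sum_sub_distrib]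
  refine Valuation.map_sum_le _ fun i _ => ?_
  rw [← sub_mul, map_mul, map_pow]
  exact (mul_le_of_le_one_right' (pow_le_one' hf i)).trans (p.valuation_aeval_sub_le hs _)

theorem exists_valuation_sub_lt_of_aeval [IsAlgClosed C] {f : K} {Q : C[X]} (hQ : Q ≠ 0)
    (h : p.ring.valuation (aeval f Q) < 1) :
    ∃ c : C, p.ring.valuation (f - algebraMap C K c) < 1 := by
  by_contra! hc
  refine h.not_ge ?_
  conv_rhs => rw [(IsAlgClosed.splits Q).eq_prod_roots]
  rw [map_mul, aeval_C, map_mul, p.valuation_algebraMap (leadingCoeff_ne_zero.mpr hQ), one_mul]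
  induction Q.roots using Multiset.induction with
  | empty => simp
  | cons a s ih =>
    rw [Multiset.map_cons, Multiset.prod_cons, map_mul, map_mul]
    exact one_le_mul (by simpa using hc a) ih

theorem exists_valuation_lt_one : ∃ s : K, s ≠ 0 ∧ p.ring.valuation s < 1 := by
  obtain ⟨f, hf⟩ : ∃ f, f ∉ p.ring := by
    by_contra! h
    exact p.ne_top (ValuationSubring.ext _ _ fun f => by simp [h f])
  have hf0 : f ≠ 0 := by
    rintro rfl
    exact hf p.ring.zero_mem
  refine ⟨f⁻¹, inv_ne_zero hf0, ?_⟩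
  rw [← p.ring.valuation_le_one_iff, not_le] at hf
  rw [map_inv₀]
  exact inv_lt_one_of_one_lt₀ hf

/-- The valuation of a local parameter is the largest one below one. -/
theorem _root_.Covering.IsLocalParameter.valuation_le {p : Point C K} {t : K}
    (ht : IsLocalParameter p t) {f : K} (hf : p.ring.valuation f < 1) :
    p.ring.valuation f ≤ p.ring.valuation t := by
  obtain ⟨h, hmax⟩ := ht
  have hf' : f ∈ p.ring := (p.ring.valuation_le_one_iff f).mp hf.le
  have hm : (⟨f, hf'⟩ : p.ring) ∈ IsLocalRing.maximalIdeal p.ring :=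
    (p.ring.valuation_lt_one_iff _).mpr hf
  rw [hmax, Ideal.mem_span_singleton] at hm
  obtain ⟨b, hb⟩ := hm
  have : f = t * b := congrArg Subtype.val hb
  rw [this, map_mul]
  exact mul_le_of_le_one_right' (p.ring.valuation_le_one b)

theorem _root_.Covering.IsLocalParameter.valuation_lt_one {p : Point C K} {t : K}
    (ht : IsLocalParameter p t) : p.ring.valuation t < 1 := by
  obtain ⟨h, hmax⟩ := ht
  refine (p.ring.valuation_lt_one_iff ⟨t, h⟩).mp ?_
  rw [hmax]
  exact Ideal.mem_span_singleton_self _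

theorem _root_.Covering.IsLocalParameter.ne_zero {p : Point C K} {t : K}
    (ht : IsLocalParameter p t) : t ≠ 0 := by
  rintro rfl
  obtain ⟨s, hs0, hs⟩ := p.exists_valuation_lt_one
  have := ht.valuation_le hs
  rw [map_zero, le_zero_iff, map_eq_zero] at this
  exact hs0 this

variable [Algebra (RatFunc C) K] [IsScalarTower C (RatFunc C) K] [FiniteDimensional (RatFunc C) K]

/-- The residue field at a point is the algebraically closed field of constants: a function that is
regular at the point has a value in `C`. A relation between the function and one that vanishes at
the point becomes an equation for the value. -/
theorem exists_valuation_sub_lt [IsAlgClosed C] {f : K} (hf : p.ring.valuation f ≤ 1) :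
    ∃ c : C, p.ring.valuation (f - algebraMap C K c) < 1 := by
  obtain ⟨s, hs0, hs⟩ := p.exists_valuation_lt_one
  obtain ⟨P, hP, hPf⟩ := exists_polynomial_relation (C := C) s f
  -- the relation is divided by the highest power of its first variable
  obtain ⟨Q, hQ, hd⟩ := (FiniteMultiplicity.of_not_isUnit (a := (Polynomial.C X : C[X][X]))
    (by simp [not_isUnit_X]) hP).exists_eq_pow_mul_and_not_dvd
  have hQf : Q.eval₂ (eval₂RingHom (algebraMap C K) s) f = 0 := by
    rw [hQ, eval₂_mul, eval₂_pow, eval₂_C] at hPf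
    refine (mul_eq_zero.mp hPf).resolve_left (pow_ne_zero _ ?_)
    simpa using hs0
  refine p.exists_valuation_sub_lt_of_aeval (Q := Q.map constantCoeff) (fun h0 => hd ?_) ?_
  · rw [C_dvd_iff_dvd_coeff]
    intro i
    have := congrArg (fun R => R.coeff i) h0
    rw [X_dvd_iff]
    simpa using this
  · have := p.valuation_eval₂_sub_le hs.le hf Q
    rw [hQf, zero_sub, Valuation.map_neg] at this
    exact this.trans_lt hs

/-- The valuation of a point has rank one. -/
theorem exists_pow_valuation_le {s f : K} (hs : p.ring.valuation s < 1) (hf : f ≠ 0) :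
    ∃ n : ℕ, p.ring.valuation s ^ n ≤ p.ring.valuation f := by
  rcases le_or_gt 1 (p.ring.valuation f) with h1 | h1
  · exact ⟨0, by simpa using h1⟩
  obtain ⟨P, hP, hPf⟩ := exists_polynomial_relation (C := C) s f
  -- the relation is divided by the highest power of its second variable
  obtain ⟨Q, hQ, hd⟩ := (FiniteMultiplicity.of_not_isUnit (a := (X : C[X][X]))
    not_isUnit_X hP).exists_eq_pow_mul_and_not_dvd
  have hQf : Q.eval₂ (eval₂RingHom (algebraMap C K) s) f = 0 := by
    rw [hQ, eval₂_mul, eval₂_pow, eval₂_X] at hPf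
    exact (mul_eq_zero.mp hPf).resolve_left (pow_ne_zero _ hf)
  rw [X_dvd_iff] at hd
  obtain ⟨m, -, hm⟩ := p.exists_valuation_aeval hs hd
  refine ⟨m, ?_⟩
  rw [← X_mul_divX_add Q, eval₂_add, eval₂_mul, eval₂_X, eval₂_C] at hQf
  have h2 : aeval s (Q.coeff 0) = -(f * Q.divX.eval₂ (eval₂RingHom (algebraMap C K) s) f) := by
    rw [aeval_def, ← coe_eval₂RingHom]
    linear_combination hQf
  rw [← hm, h2, Valuation.map_neg, map_mul]
  exact mul_le_of_le_one_right' (p.valuation_eval₂_le_one hs.le h1.le _)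

end Covering.Point

/-! ### Convergent local expansions -/

namespace Covering.Point

open Polynomial

variable {C : Type u} {K : Type v} [Field C] [Field K] [Algebra C K] (p : Point C K) {t : K}

/-- The power series `g` is an asymptotic expansion of the function `f` in powers of `t`: up to any
order, some polynomial that approximates `g` also approximates `f`. -/
def IsAsymptotic (t f : K) (g : PowerSeries C) : Prop :=
  ∀ n : ℕ, ∃ q : C[X], PowerSeries.X ^ n ∣ g - (q : PowerSeries C) ∧
    p.ring.valuation (f - aeval t q) ≤ p.ring.valuation t ^ n

variable {p}

theorem isAsymptotic_aeval (q : C[X]) : p.IsAsymptotic t (aeval t q) (q : PowerSeries C) :=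
  fun n => ⟨q, by simp, by simp⟩

theorem IsAsymptotic.add {f f' : K} {g g' : PowerSeries C} (h : p.IsAsymptotic t f g)
    (h' : p.IsAsymptotic t f' g') : p.IsAsymptotic t (f + f') (g + g') := by
  intro n
  obtain ⟨q, hq, hf⟩ := h n
  obtain ⟨q', hq', hf'⟩ := h' n
  refine ⟨q + q', ?_, ?_⟩
  · rw [coe_add, add_sub_add_comm]
    exact dvd_add hq hq'
  · rw [map_add, add_sub_add_comm]
    exact Valuation.map_add_le _ hf hf'

theorem IsAsymptotic.mul (ht : p.ring.valuation t ≤ 1) {f f' : K} {g g' : PowerSeries C}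
    (hf1 : p.ring.valuation f ≤ 1) (h : p.IsAsymptotic t f g) (h' : p.IsAsymptotic t f' g') :
    p.IsAsymptotic t (f * f') (g * g') := by
  intro n
  obtain ⟨q, hq, hf⟩ := h n
  obtain ⟨q', hq', hf'⟩ := h' n
  refine ⟨q * q', ?_, ?_⟩
  · rw [coe_mul, show g * g' - (q : PowerSeries C) * q' = g * (g' - q') + q' * (g - q) by ring]
    exact dvd_add (hq'.mul_left _) (hq.mul_left _)
  · rw [map_mul, show f * f' - aeval t q * aeval t q' =
      f * (f' - aeval t q') + aeval t q' * (f - aeval t q) by ring]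
    refine Valuation.map_add_le _ ?_ ?_
    · rw [map_mul]
      exact mul_le_of_le_one_of_le hf1 hf'
    · rw [map_mul]
      exact mul_le_of_le_one_of_le (p.valuation_aeval_le_one ht q') hf

theorem IsAsymptotic.unique (ht : p.ring.valuation t < 1) (ht0 : t ≠ 0) {f : K}
    {g g' : PowerSeries C} (h : p.IsAsymptotic t f g) (h' : p.IsAsymptotic t f g') : g = g' := by
  have hpos : 0 < p.ring.valuation t := zero_lt_iff.mpr (by simpa using ht0)
  refine sub_eq_zero.mp (PowerSeries.ext fun k => ?_)
  obtain ⟨q, hq, hf⟩ := h (k + 1)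
  obtain ⟨q', hq', hf'⟩ := h' (k + 1)
  have hd : X ^ (k + 1) ∣ q - q' := by
    by_cases h0 : q - q' = 0
    · simp [h0]
    obtain ⟨m, hm, hv⟩ := p.exists_valuation_aeval ht h0
    refine (pow_dvd_pow _ ?_).trans hm
    have hle : p.ring.valuation t ^ m ≤ p.ring.valuation t ^ (k + 1) := by
      rw [← hv, map_sub, ← sub_sub_sub_cancel_left _ _ f]
      exact Valuation.map_sub_le _ hf' hf
    exact (pow_le_pow_iff_right_of_lt_one₀ hpos ht).mp hle
  have hd' : PowerSeries.X ^ (k + 1) ∣ (q : PowerSeries C) - (q' : PowerSeries C) := by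
    obtain ⟨b, hb⟩ := hd
    exact ⟨b, by rw [← coe_sub, hb]; simp⟩
  have : PowerSeries.X ^ (k + 1) ∣ g - g' := by
    have := dvd_add (dvd_sub hq hq') hd'
    rwa [sub_sub_sub_comm, sub_add_cancel] at this
  rw [map_zero]
  exact PowerSeries.X_pow_dvd_iff.mp this k (by omega)

variable [Algebra (RatFunc C) K] [IsScalarTower C (RatFunc C) K] [FiniteDimensional (RatFunc C) K]

theorem IsAsymptotic.eq_zero (ht : p.ring.valuation t < 1) (ht0 : t ≠ 0) {f : K}
    (h : p.IsAsymptotic t f 0) : f = 0 := by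
  by_contra hf
  have hpos : 0 < p.ring.valuation t := zero_lt_iff.mpr (by simpa using ht0)
  obtain ⟨n, hn⟩ := p.exists_pow_valuation_le ht hf
  obtain ⟨q, hq, hfq⟩ := h (n + 1)
  obtain ⟨b, rfl⟩ : X ^ (n + 1) ∣ q := by
    rw [zero_sub, dvd_neg, PowerSeries.X_pow_dvd_iff] at hq
    rw [X_pow_dvd_iff]
    simpa using hq
  have hq' : p.ring.valuation (aeval t (X ^ (n + 1) * b)) ≤ p.ring.valuation t ^ (n + 1) := by
    rw [map_mul, map_pow, aeval_X, map_mul, map_pow]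
    exact mul_le_of_le_one_right' (p.valuation_aeval_le_one ht.le b)
  have hf' := Valuation.map_add_le _ hfq hq'
  rw [sub_add_cancel] at hf'
  exact (pow_lt_pow_right_of_lt_one₀ hpos ht n.lt_succ_self).not_ge (hn.trans hf')

/-- A regular function has an asymptotic expansion: its coefficients are the values of the
successive remainders. -/
theorem exists_isAsymptotic [IsAlgClosed C] (ht : IsLocalParameter p t) {f : K}
    (hf : p.ring.valuation f ≤ 1) : ∃ g : PowerSeries C, p.IsAsymptotic t f g := by
  have ht0 := ht.ne_zero
  have hpos : 0 < p.ring.valuation t := zero_lt_iff.mpr (by simpa using ht0)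
  choose! c hc using fun (f : K) (hf : p.ring.valuation f ≤ 1) => p.exists_valuation_sub_lt hf
  set a : ℕ → K := fun n => (fun z => (z - algebraMap C K (c z)) / t)^[n] f with ha
  have hsucc : ∀ n, a (n + 1) = (a n - algebraMap C K (c (a n))) / t := fun n =>
    Function.iterate_succ_apply' _ _ _
  have hle : ∀ n, p.ring.valuation (a n) ≤ 1 := by
    intro n
    induction n with
    | zero => exact hf
    | succ n ih =>
      rw [hsucc, map_div₀]
      exact div_le_one_of_le₀ (ht.valuation_le (hc _ ih)) hpos.le
  refine ⟨PowerSeries.mk fun n => c (a n), fun n =>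
    ⟨PowerSeries.trunc n (PowerSeries.mk fun n => c (a n)), ?_, ?_⟩⟩
  · rw [PowerSeries.X_pow_dvd_iff]
    intro m hm
    simp [PowerSeries.coeff_trunc, hm]
  · have : f - aeval t (PowerSeries.trunc n (PowerSeries.mk fun n => c (a n))) = t ^ n * a n := by
      induction n with
      | zero => simp [ha]
      | succ n ih =>
        rw [PowerSeries.trunc_succ, map_add, ← sub_sub, ih, hsucc, aeval_monomial,
          PowerSeries.coeff_mk]
        field_simp
        ring
    rw [this, map_mul, map_pow]
    exact mul_le_of_le_one_right' (hle n)

/-- Every point has local expansions with respect to each of its local parameters, and these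
expansions are convergent, since functions are algebraic over the field of rational functions of the
parameter. -/
theorem exists_isLocalExpansion [IsAlgClosed C] (ι : C →+* ℂ) (ht : IsLocalParameter p t) :
    ∃ φ : K →ₗ[C] LaurentSeries C, IsLocalExpansion p t φ ∧
      ∀ (n : ℤ) (f : K), p.ring.valuation f ≤ p.ring.valuation t ^ n →
        ∃ b : ConvergentSeries ι, φ f = powMul ι n b := by
  have ht1 := ht.valuation_lt_one
  have ht0 := ht.ne_zero
  choose e he using fun f : p.ring => exists_isAsymptotic ht (p.ring.valuation_le_one f)
  have huniq : ∀ (f : p.ring) (g : PowerSeries C), p.IsAsymptotic t f g → e f = g :=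
    fun f g h => (he f).unique ht1 ht0 h
  have hconst : ∀ (c : C) (h : algebraMap C K c ∈ p.ring), e ⟨_, h⟩ = PowerSeries.C c := by
    intro c h
    refine huniq _ _ ?_
    have := isAsymptotic_aeval (p := p) (t := t) (Polynomial.C c)
    simpa using this
  let E : p.ring →+* PowerSeries C :=
    { toFun := e
      map_one' := huniq _ _ (by simpa using isAsymptotic_aeval (p := p) (t := t) 1)
      map_mul' := fun f g => huniq _ _ ((he f).mul ht1.le (p.ring.valuation_le_one f) (he g))
      map_zero' := huniq _ _ (by simpa using isAsymptotic_aeval (p := p) (t := t) 0)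
      map_add' := fun f g => huniq _ _ ((he f).add (he g)) }
  have hEinj : Function.Injective ((HahnSeries.ofPowerSeries ℤ C).comp E) := by
    rw [RingHom.coe_comp]
    refine HahnSeries.ofPowerSeries_injective.comp
      ((injective_iff_map_eq_zero E).mpr fun f hf => ?_)
    have := he f
    rw [show e f = 0 from hf] at this
    exact Subtype.ext (this.eq_zero ht1 ht0)
  let ψ : K →+* LaurentSeries C := IsFractionRing.lift hEinj
  have hψ : ∀ f : p.ring, ψ f = HahnSeries.ofPowerSeries ℤ C (e f) :=
    fun f => IsFractionRing.lift_algebraMap hEinj f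
  have hψC : ∀ c : C, ψ (algebraMap C K c) = HahnSeries.C c := by
    intro c
    rw [hψ ⟨_, p.const_mem c⟩, hconst, HahnSeries.ofPowerSeries_C]
  have hψt : ψ t = HahnSeries.single 1 1 := by
    have htm : t ∈ p.ring := (p.ring.valuation_le_one_iff t).mp ht1.le
    rw [hψ ⟨t, htm⟩, huniq ⟨t, htm⟩ PowerSeries.X
      (by simpa using isAsymptotic_aeval (p := p) (t := t) X), HahnSeries.ofPowerSeries_X]
  have hconv : ∀ f : p.ring, e f ∈ ConvergentSeries ι := by
    intro f
    obtain ⟨P, hP, hPf⟩ := exists_polynomial_relation (C := C) t (f : K)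
    refine mem_convergentSeries_of_algebraic ι hP ?_
    apply HahnSeries.ofPowerSeries_injective (Γ := ℤ)
    have := congrArg ψ hPf
    rw [hom_eval₂, map_zero, hψ] at this
    rw [coe_eval₂RingHom, hom_eval₂, map_zero, ← this]
    congr 1
    refine ringHom_ext (fun c => ?_) ?_
    · simp [hψC]
    · simp [hψt]
  refine ⟨{ toFun := ψ, map_add' := map_add ψ, map_smul' := fun c f => ?_ },
    ⟨map_one ψ, map_mul ψ, hψt, fun f hf => ⟨e ⟨f, hf⟩, hψ ⟨f, hf⟩⟩⟩, fun n f hf => ?_⟩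
  · rw [Algebra.smul_def, map_mul, hψC, HahnSeries.C_mul_eq_smul, RingHom.id_apply]
  · have hpos : 0 < p.ring.valuation t := zero_lt_iff.mpr (by simpa using ht0)
    have hf1 : f / t ^ n ∈ p.ring := by
      rw [← p.ring.valuation_le_one_iff, map_div₀, map_zpow₀]
      exact div_le_one_of_le₀ hf (zpow_pos hpos n).le
    refine ⟨⟨e ⟨_, hf1⟩, hconv _⟩, ?_⟩
    change ψ f = HahnSeries.single n 1 * HahnSeries.ofPowerSeries ℤ C (e ⟨_, hf1⟩)
    rw [← hψ, map_div₀, map_zpow₀, hψt, ← RatFunc.single_zpow, mul_div_cancel₀]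
    simp

end Covering.Point

/-! ### Equivariant elements with prescribed expansions -/

namespace Covering

section

variable {C : Type u} {K : Type v} [Field C] [Field K] [Algebra (RatFunc C) K] [Algebra C K]
  [IsScalarTower C (RatFunc C) K]

theorem galois_algebraMap (h : K ≃ₐ[RatFunc C] K) (c : C) :
    h (algebraMap C K c) = algebraMap C K c :=
  (h.restrictScalars C).commutes c

/-- The average of an element of `V(K)` over the group `H` is equivariant. -/
theorem isEquivariant_sum_map [Fintype (K ≃ₐ[RatFunc C] K)] {V : Type w} [AddCommMonoid V]
    [Module C V] (ρ : Representation C (K ≃ₐ[RatFunc C] K)ᵐᵒᵖ V) (A : K ⊗[C] V) :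
    IsEquivariant ρ (∑ h : K ≃ₐ[RatFunc C] K, TensorProduct.map
      (h.restrictScalars C).toLinearMap (ρ (MulOpposite.op h⁻¹)) A) := by
  intro g
  rw [map_sum, map_sum]
  rw [← Equiv.sum_comp (Equiv.mulLeft g) fun h => LinearMap.lTensor K (ρ (MulOpposite.op g))
    (TensorProduct.map (h.restrictScalars C).toLinearMap (ρ (MulOpposite.op h⁻¹)) A)]
  refine Finset.sum_congr rfl fun h _ => ?_
  have hρ : ρ (MulOpposite.op g) ∘ₗ ρ (MulOpposite.op (g * h)⁻¹) = ρ (MulOpposite.op h⁻¹) := by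
    rw [← Module.End.mul_eq_comp, ← map_mul, ← MulOpposite.op_mul, mul_inv_rev,
      inv_mul_cancel_right]
  rw [← LinearMap.comp_apply, ← LinearMap.comp_apply, LinearMap.rTensor_comp_map,
    LinearMap.lTensor_comp_map, Equiv.coe_mulLeft, hρ]
  rfl

end

section

variable {K : Type v} [Field K] {Γ : Type*} [LinearOrderedCommGroupWithZero Γ]
  (v : Valuation K Γ)

theorem valuation_one_sub_pow_le {a : K} (ha : v a ≤ 1) (L : ℕ) : v (1 - a ^ L) ≤ v (1 - a) := by
  induction L with
  | zero => simp
  | succ L ih =>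
    rw [show 1 - a ^ (L + 1) = (1 - a ^ L) + a ^ L * (1 - a) by ring]
    refine Valuation.map_add_le _ ih ?_
    rw [map_mul, map_pow]
    exact mul_le_of_le_one_left' (pow_le_one' ha L)

theorem valuation_le_one_of_sub_lt {a : K} (h : v (a - 1) < 1) : v a ≤ 1 := by
  have := v.map_add_le h.le (v.map_one.le)
  rwa [sub_add_cancel] at this

/-- If `z` is close to `0` or `1`, then `1 - (1 - z ^ L) ^ L` is very close to it for large `L`. -/
theorem valuation_one_sub_one_sub_pow_pow_sub_le {z δ : K} (hδ : δ = 0 ∨ δ = 1) {γ : Γ}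
    (hγ : γ ≤ 1) (h1 : v (z - δ) < 1) (h : v (z - δ) ≤ γ) (L : ℕ) :
    v (1 - (1 - z ^ L) ^ L - δ) ≤ γ ^ L := by
  rcases hδ with rfl | rfl
  · rw [sub_zero] at *
    have hz : v (z ^ L) ≤ γ ^ L := by
      rw [map_pow]
      exact pow_le_pow_left' h L
    have hw : v (1 - z ^ L) ≤ 1 :=
      v.map_sub_le v.map_one.le (hz.trans (pow_le_one' hγ L))
    refine (valuation_one_sub_pow_le v hw L).trans ?_
    rwa [sub_sub_cancel]
  · rw [sub_right_comm, sub_self, zero_sub, Valuation.map_neg, map_pow]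
    refine pow_le_pow_left' ?_ L
    refine (valuation_one_sub_pow_le v (valuation_le_one_of_sub_lt v h1) L).trans ?_
    rwa [Valuation.map_sub_swap]

theorem valuation_prod_sub_one_lt {ι : Type*} {s : Finset ι} {f : ι → K}
    (h : ∀ i ∈ s, v (f i - 1) < 1) : v (∏ i ∈ s, f i - 1) < 1 := by
  classical
  induction s using Finset.induction with
  | empty => simp
  | insert a s ha ih =>
    rw [Finset.prod_insert ha,
      show f a * ∏ i ∈ s, f i - 1 = f a * (∏ i ∈ s, f i - 1) + (f a - 1) by ring]
    have h1 := h a (Finset.mem_insert_self _ _)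
    refine v.map_add_lt ?_ h1
    rw [map_mul]
    exact (mul_le_of_le_one_left' (valuation_le_one_of_sub_lt v h1)).trans_lt
      (ih fun i hi => h i (Finset.mem_insert_of_mem hi))

theorem valuation_prod_le_one {ι : Type*} {s : Finset ι} {f : ι → K}
    (h : ∀ i ∈ s, v (f i) ≤ 1) : v (∏ i ∈ s, f i) ≤ 1 := by
  rw [map_prod]
  exact Finset.prod_le_one' h

theorem valuation_prod_lt_one {ι : Type*} {s : Finset ι} {f : ι → K}
    (h : ∀ i ∈ s, v (f i) ≤ 1) {i : ι} (hi : i ∈ s) (hlt : v (f i) < 1) :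
    v (∏ i ∈ s, f i) < 1 := by
  classical
  rw [← Finset.mul_prod_erase s f hi, map_mul]
  exact (mul_le_of_le_one_right' (valuation_prod_le_one v
    fun j hj => h j (Finset.mem_of_mem_erase hj))).trans_lt hlt

end

section

variable {C : Type u} {K : Type v} [Field C] [Field K] [Algebra (RatFunc C) K] [Algebra C K]
  [IsScalarTower C (RatFunc C) K]

/-- The function `y` is a coordinate along the fibre of the covering through `p`: its conjugates are
regular at `p`, and they have different values there. -/
def SeparatesFibre (p : Point C K) (y : K) : Prop :=
  (∀ h : K ≃ₐ[RatFunc C] K, p.ring.valuation (h y) ≤ 1) ∧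
    ∀ h : K ≃ₐ[RatFunc C] K, h ≠ 1 → 1 ≤ p.ring.valuation (h y - y)

variable [IsAlgClosed C] [FiniteDimensional (RatFunc C) K]
  {r : ℕ} {p : Fin r → Point C K} {a : Fin r → C} {y : K}

open Classical in
/-- Lagrange interpolation along the fibres and on the line: for each of the points there is a
function that has the value one there, and that vanishes at the other points of all fibres. In terms
of the conjugates of the function, only the given points occur. -/
theorem exists_interpolation (ha : ∀ i j, i ≠ j → a i ≠ a j)
    (hx : ∀ i, (p i).ring.valuation (x C K - algebraMap C K (a i)) < 1)
    (hy : ∀ i, SeparatesFibre (p i) y) :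
    ∃ E : Fin r → K, ∀ (i j : Fin r) (h : K ≃ₐ[RatFunc C] K),
      (p j).ring.valuation (h (E i) - if h = 1 ∧ i = j then 1 else 0) < 1 := by
  have : Fintype (K ≃ₐ[RatFunc C] K) := Fintype.ofFinite _
  -- `c i h` is the value of `h y` at `p i`, that is, the value of `y` at a conjugate of `p i`
  choose c hc using fun (i : Fin r) (h : K ≃ₐ[RatFunc C] K) =>
    (p i).exists_valuation_sub_lt ((hy i).1 h)
  have hc1 : ∀ i, (p i).ring.valuation (y - algebraMap C K (c i 1)) < 1 := fun i => hc i 1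
  have hcne : ∀ i h, h ≠ 1 → c i 1 - c i h ≠ 0 := by
    intro i h hh h0
    refine ((hy i).2 h hh).not_gt ?_
    have := (p i).ring.valuation.map_sub_lt (hc i h) (hc1 i)
    rwa [sub_eq_zero.mp h0, sub_sub_sub_cancel_right] at this
  have hone : ∀ (i : Fin r) (z : K) (b d : C), b - d ≠ 0 →
      (p i).ring.valuation (z - algebraMap C K b) < 1 →
      (p i).ring.valuation ((z - algebraMap C K d) * algebraMap C K (b - d)⁻¹ - 1) < 1 := by
    intro i z b d hbd hz
    have h1 : algebraMap C K (b - d) * algebraMap C K (b - d)⁻¹ = 1 := by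
      rw [← map_mul, mul_inv_cancel₀ hbd, map_one]
    have h2 : (z - algebraMap C K d) * algebraMap C K (b - d)⁻¹ - 1 =
        (z - algebraMap C K b) * algebraMap C K (b - d)⁻¹ := by
      rw [map_sub] at h1
      linear_combination h1
    rw [h2, map_mul]
    exact (mul_le_of_le_one_right' ((p i).valuation_algebraMap_le _)).trans_lt hz
  have hzero : ∀ (i : Fin r) (z : K) (d e : C), (p i).ring.valuation (z - algebraMap C K d) < 1 →
      (p i).ring.valuation ((z - algebraMap C K d) * algebraMap C K e) < 1 := by
    intro i z d e hz
    rw [map_mul]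
    exact (mul_le_of_le_one_right' ((p i).valuation_algebraMap_le _)).trans_lt hz
  have hreg : ∀ (i : Fin r) (z : K) (d e : C), (p i).ring.valuation z ≤ 1 →
      (p i).ring.valuation ((z - algebraMap C K d) * algebraMap C K e) ≤ 1 := by
    intro i z d e hz
    rw [map_mul]
    exact mul_le_one' (Valuation.map_sub_le _ hz ((p i).valuation_algebraMap_le _))
      ((p i).valuation_algebraMap_le _)
  have hxreg : ∀ i, (p i).ring.valuation (x C K) ≤ 1 := by
    intro i
    have := Valuation.map_add_le _ (hx i).le ((p i).valuation_algebraMap_le (a i))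
    rwa [sub_add_cancel] at this
  let Y : Fin r → (K ≃ₐ[RatFunc C] K) → K := fun i h =>
    (y - algebraMap C K (c i h)) * algebraMap C K (c i 1 - c i h)⁻¹
  let Z : Fin r → Fin r → K := fun i j =>
    (x C K - algebraMap C K (a j)) * algebraMap C K (a i - a j)⁻¹
  have hY : ∀ (g : K ≃ₐ[RatFunc C] K) (i : Fin r) (h : K ≃ₐ[RatFunc C] K),
      g (Y i h) = (g y - algebraMap C K (c i h)) * algebraMap C K (c i 1 - c i h)⁻¹ := by
    intro g i h
    rw [map_mul, map_sub, galois_algebraMap, galois_algebraMap]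
  have hZ : ∀ (g : K ≃ₐ[RatFunc C] K) (i j : Fin r), g (Z i j) = Z i j := by
    intro g i j
    rw [map_mul, map_sub, galois_algebraMap, galois_algebraMap, x, g.commutes]
    rfl
  refine ⟨fun i => (∏ h ∈ Finset.univ.erase 1, Y i h) * ∏ j ∈ Finset.univ.erase i, Z i j,
    fun i j h => ?_⟩
  have hYreg : (p j).ring.valuation (∏ g ∈ Finset.univ.erase 1, h (Y i g)) ≤ 1 :=
    valuation_prod_le_one _ fun g _ => by
      rw [hY]
      exact hreg _ _ _ _ ((hy j).1 h)
  have hZreg : (p j).ring.valuation (∏ l ∈ Finset.univ.erase i, h (Z i l)) ≤ 1 :=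
    valuation_prod_le_one _ fun l _ => by
      rw [hZ]
      exact hreg _ _ _ _ (hxreg j)
  rw [map_mul, map_prod, map_prod]
  by_cases hij : i = j
  · subst hij
    by_cases hh : h = 1
    · subst hh
      rw [if_pos ⟨rfl, rfl⟩]
      have h1 : (p i).ring.valuation (∏ g ∈ Finset.univ.erase 1, (1 : K ≃ₐ[RatFunc C] K) (Y i g)
          - 1) < 1 :=
        valuation_prod_sub_one_lt _ fun g hg =>
          hone i y _ _ (hcne i g (Finset.ne_of_mem_erase hg)) (hc1 i)
      have h2 : (p i).ring.valuation (∏ l ∈ Finset.univ.erase i, (1 : K ≃ₐ[RatFunc C] K) (Z i l)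
          - 1) < 1 :=
        valuation_prod_sub_one_lt _ fun l hl =>
          hone i _ _ _ (sub_ne_zero.mpr (ha i l (Finset.ne_of_mem_erase hl).symm)) (hx i)
      rw [← sub_add_sub_cancel _ (∏ l ∈ Finset.univ.erase i, (1 : K ≃ₐ[RatFunc C] K) (Z i l)),
        ← sub_one_mul]
      refine Valuation.map_add_lt _ ?_ h2
      rw [map_mul]
      exact (mul_le_of_le_one_right' hZreg).trans_lt h1
    · rw [if_neg (by tauto), sub_zero, map_mul]
      refine (mul_le_of_le_one_right' hZreg).trans_lt (valuation_prod_lt_one _ (fun g _ => ?_)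
        (Finset.mem_erase.mpr ⟨hh, Finset.mem_univ h⟩) ?_)
      · rw [hY]
        exact hreg _ _ _ _ ((hy i).1 h)
      · rw [hY]
        exact hzero _ _ _ _ (hc i h)
  · rw [if_neg (by tauto), sub_zero, map_mul]
    refine (mul_le_of_le_one_left' hYreg).trans_lt (valuation_prod_lt_one _ (fun l _ => ?_)
        (Finset.mem_erase.mpr ⟨Ne.symm hij, Finset.mem_univ j⟩) ?_)
    · rw [hZ]
      exact hreg _ _ _ _ (hxreg j)
    · rw [hZ]
      exact hzero _ _ _ _ (hx j)

open Classical in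
/-- The approximation theorem for the conjugates of finitely many points: there are functions that
approximate the value one at the given points, and zero at their other conjugates, so well that they
outweigh the poles of the powers of the local parameters. -/
theorem exists_approximation (ha : ∀ i j, i ≠ j → a i ≠ a j)
    (hx : ∀ i, (p i).ring.valuation (x C K - algebraMap C K (a i)) < 1)
    (hy : ∀ i, SeparatesFibre (p i) y) {t : Fin r → K} (ht : ∀ i, IsLocalParameter (p i) (t i))
    (M N : ℤ) :
    ∃ e : Fin r → K, ∀ (i j : Fin r) (h : K ≃ₐ[RatFunc C] K), ∀ k ∈ Finset.Icc M N,
      (p j).ring.valuation (h (e i * t i ^ k) - if h = 1 ∧ i = j then t j ^ k else 0) ≤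
        (p j).ring.valuation (t j) ^ (N + 1) := by
  obtain ⟨E, hE⟩ := exists_interpolation ha hx hy
  have : Fintype (K ≃ₐ[RatFunc C] K) := Fintype.ofFinite _
  have htne : ∀ (i : Fin r) (h : K ≃ₐ[RatFunc C] K) (k : ℤ), h (t i ^ k) ≠ 0 := fun i h k =>
    (map_ne_zero h).mpr (zpow_ne_zero k (ht i).ne_zero)
  choose n hn using fun (q : Fin r × Fin r × (K ≃ₐ[RatFunc C] K) × ℤ) =>
    (p q.2.1).exists_pow_valuation_le (ht q.2.1).valuation_lt_one
      (div_ne_zero (zpow_ne_zero (N + 1) (ht q.2.1).ne_zero) (htne q.1 q.2.2.1 q.2.2.2))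
  -- `T.sup n` is large enough to outweigh each of these finitely many poles
  let T : Finset (Fin r × Fin r × (K ≃ₐ[RatFunc C] K) × ℤ) :=
    Finset.univ ×ˢ Finset.univ ×ˢ Finset.univ ×ˢ Finset.Icc M N
  refine ⟨fun i => 1 - (1 - E i ^ T.sup n) ^ T.sup n, fun i j h k hk => ?_⟩
  have hmem : (i, j, h, k) ∈ T := by simpa [T] using hk
  have hlt := (ht j).valuation_lt_one
  have h1 := valuation_one_sub_one_sub_pow_pow_sub_le (p j).ring.valuation
    (z := h (E i)) (δ := if h = 1 ∧ i = j then 1 else 0) (by split_ifs <;> simp) hlt.le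
    (hE i j h) ((ht j).valuation_le (hE i j h)) (T.sup n)
  have h2 : h ((1 - (1 - E i ^ T.sup n) ^ T.sup n) * t i ^ k) -
      (if h = 1 ∧ i = j then t j ^ k else 0) =
      (1 - (1 - h (E i) ^ T.sup n) ^ T.sup n - if h = 1 ∧ i = j then 1 else 0) * h (t i ^ k) := by
    split_ifs with hh
    · obtain ⟨rfl, rfl⟩ := hh
      simp only [AlgEquiv.one_apply]
      ring
    · rw [sub_zero, sub_zero, map_mul, map_sub, map_pow, map_sub, map_pow, map_one]
  have hle : (p j).ring.valuation (t j) ^ T.sup n ≤ (p j).ring.valuation (t j) ^ n (i, j, h, k) :=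
    pow_le_pow_right_of_le_one' hlt.le (Finset.le_sup hmem)
  have h3 := (h1.trans hle).trans (hn (i, j, h, k))
  rw [h2, map_mul]
  refine (mul_le_mul_left h3 _).trans_eq ?_
  rw [← map_mul, div_mul_cancel₀ _ (htne i h k), map_zpow₀]

/-- Coefficients of the expansion of an equivariant element can be prescribed at points whose fibres
are separated by a function `y`. -/
theorem exists_isEquivariant_hasExpansion (ι : C →+* ℂ) (ha : ∀ i j, i ≠ j → a i ≠ a j)
    (hx : ∀ i, (p i).ring.valuation (x C K - algebraMap C K (a i)) < 1)
    (hy : ∀ i, SeparatesFibre (p i) y) {t : Fin r → K} (ht : ∀ i, IsLocalParameter (p i) (t i))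
    (M N : ℤ) {V : Type w} [AddCommMonoid V] [Module C V]
    (ρ : Representation C (K ≃ₐ[RatFunc C] K)ᵐᵒᵖ V) (coef : Fin r → ℤ → V) :
    ∃ A : K ⊗[C] V, IsEquivariant ρ A ∧ ∀ i, HasExpansion ι (p i) (t i) M N (coef i) A := by
  classical
  obtain ⟨e, he⟩ := exists_approximation ha hx hy ht M N
  have : Fintype (K ≃ₐ[RatFunc C] K) := Fintype.ofFinite _
  refine ⟨_, isEquivariant_sum_map ρ
    (∑ i, ∑ k ∈ Finset.Icc M N, (e i * t i ^ k) ⊗ₜ[C] coef i k), fun j => ?_⟩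
  obtain ⟨φ, hφ, hconv⟩ := Point.exists_isLocalExpansion ι (ht j)
  choose! b hb using fun (i : Fin r) (h : K ≃ₐ[RatFunc C] K) (k : ℤ) (hk : k ∈ Finset.Icc M N) =>
    hconv (N + 1) _ (he i j h k hk)
  have hφt : ∀ k : ℤ, φ (t j ^ k) = HahnSeries.single k 1 := by
    intro k
    let ψ : K →+* LaurentSeries C :=
      { toFun := φ, map_one' := hφ.map_one, map_mul' := hφ.map_mul, map_zero' := map_zero φ,
        map_add' := map_add φ }
    have : ψ (t j ^ k) = ψ (t j) ^ k := map_zpow₀ ψ _ _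
    rw [RatFunc.single_zpow, ← hφ.map_parameter]
    exact this
  have hφe : ∀ (i : Fin r) (h : K ≃ₐ[RatFunc C] K), ∀ k ∈ Finset.Icc M N,
      φ (h (e i * t i ^ k)) =
        (if h = 1 ∧ i = j then HahnSeries.single k 1 else 0) + powMul ι (N + 1) (b i h k) := by
    intro i h k hk
    rw [← hb i h k hk, map_sub]
    split_ifs
    · rw [hφt, add_sub_cancel]
    · rw [map_zero, sub_zero, zero_add]
  refine ⟨φ, hφ, ∑ h : K ≃ₐ[RatFunc C] K, ∑ i, ∑ k ∈ Finset.Icc M N,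
    b i h k ⊗ₜ[C] ρ (MulOpposite.op h⁻¹) (coef i k), ?_⟩
  simp only [map_sum, TensorProduct.map_tmul, LinearMap.rTensor_tmul]
  have hsum : ∀ (h : K ≃ₐ[RatFunc C] K) (i : Fin r), ∀ k ∈ Finset.Icc M N,
      φ ((h.restrictScalars C).toLinearMap (e i * t i ^ k)) ⊗ₜ[C]
        ρ (MulOpposite.op h⁻¹) (coef i k) =
      (if h = 1 ∧ i = j then HahnSeries.single k (1 : C) ⊗ₜ[C] coef j k else 0) +
        powMul ι (N + 1) (b i h k) ⊗ₜ[C] ρ (MulOpposite.op h⁻¹) (coef i k) := by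
    intro h i k hk
    have := hφe i h k hk
    change φ (h (e i * t i ^ k)) ⊗ₜ[C] _ = _
    rw [this, TensorProduct.add_tmul]
    congr 1
    split_ifs with hh
    · obtain ⟨rfl, rfl⟩ := hh
      simp
    · rw [TensorProduct.zero_tmul]
  rw [Finset.sum_congr rfl fun h _ => Finset.sum_congr rfl fun i _ =>
    Finset.sum_congr rfl (hsum h i)]
  simp only [Finset.sum_add_distrib]
  congr 1
  rw [Finset.sum_eq_single 1, Finset.sum_eq_single j]
  · simp
  · intro i _ hi
    simp [hi]
  · simp
  · intro h _ hh
    simp [hh]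
  · simp

/-- A set of points of the line is exceptional if it contains infinity and some function separates
all fibres outside it. -/
theorem isExceptionalSet_of_separatesFibre (ι : C →+* ℂ) {S : Set (OnePoint C)} (hS : ∞ ∈ S)
    (hy : ∀ q : Point C K, ∀ b : C, (b : OnePoint C) ∉ S →
      q.ring.valuation (x C K - algebraMap C K b) < 1 → SeparatesFibre q y) :
    IsExceptionalSet.{u, v, w} ι K S := by
  intro R _ _ _ _ θ M N _ r p hpS hpne t ht coef
  have key : ∀ i, ∃ b : C, proj (p i) = b ∧
      (p i).ring.valuation (x C K - algebraMap C K b) < 1 := by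
    intro i
    have := hpS i
    by_cases h : ∃ b : C, x C K - algebraMap C K b ∈ (p i).ring.nonunits
    · exact ⟨h.choose, by rw [proj, dif_pos h],
        (ValuationSubring.mem_nonunits_iff _).mp h.choose_spec⟩
    · rw [proj, dif_neg h] at this
      exact absurd hS this
  choose a hproj hx using key
  refine exists_isEquivariant_hasExpansion (a := a) (y := y) ι (fun i j hij h => ?_) hx
    (fun i => hy _ (a i) ?_ (hx i)) ht M N (lieAction θ) coef
  · exact hpne i j hij (by rw [hproj, hproj, h])
  · rw [← hproj]
    exact hpS i

end

end Covering

/-! ### Equations of the covering and their bad fibres -/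

namespace Covering

open Polynomial

/-- The polynomial `D(x)` controls the bad fibres of the covering `F(x, y) = 0`: it is a combination
of `F` and `∂F/∂y`, and it is the coefficient of the highest power of `y` in a multiple of `F`.
Where `D` does not vanish, the roots of `F` are finite and simple. -/
def ControlsFibres {k : Type*} [Field k] (F : k[X][X]) (D : k[X]) : Prop :=
  (∃ U V : k[X][X], U * F + V * derivative F = C D) ∧
    ∃ (W G : k[X][X]) (m : ℕ), G.degree < m ∧ W * F = G + C D * X ^ m

variable {C : Type u} {K : Type v} {k : Type*} [Field C] [Field K] [Algebra (RatFunc C) K]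
  [Algebra C K] [Field k] [Algebra k C]

theorem ControlsFibres.separatesFibre [IsScalarTower C (RatFunc C) K] {F : k[X][X]} {D : k[X]}
    (hFD : ControlsFibres F D) {y : K} (hy : IntermediateField.adjoin (RatFunc C) {y} = ⊤)
    (hF : F.eval₂ (eval₂RingHom ((algebraMap C K).comp (algebraMap k C)) (x C K)) y = 0)
    (p : Point C K) {b : C} (hx : p.ring.valuation (x C K - algebraMap C K b) < 1)
    (hD : aeval b D ≠ 0) : SeparatesFibre p y := by
  obtain ⟨⟨U, V, hUV⟩, W, G, m, hG, hW⟩ := hFD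
  set ev := eval₂RingHom ((algebraMap C K).comp (algebraMap k C)) (x C K) with hev
  have hxreg : p.ring.valuation (x C K) ≤ 1 := by
    have := Valuation.map_add_le _ hx.le (p.valuation_algebraMap_le b)
    rwa [sub_add_cancel] at this
  have hevmap : ∀ d : k[X], ev d = aeval (x C K) (d.map (algebraMap k C)) := fun d => by
    rw [aeval_def, eval₂_map]
    rfl
  have hevreg : ∀ d : k[X], p.ring.valuation (ev d) ≤ 1 := fun d => by
    rw [hevmap]
    exact p.valuation_aeval_le_one hxreg _
  have hevD : p.ring.valuation (ev D) = 1 := by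
    have h1 : ev D = aeval (x C K - algebraMap C K b)
        ((D.map (algebraMap k C)).comp (X + Polynomial.C b)) := by
      rw [hevmap, aeval_comp]
      simp
    rw [h1]
    refine p.valuation_aeval_eq_one hx ?_
    rwa [coeff_zero_eq_eval_zero, eval_comp, eval_add, eval_X, eval_C, zero_add, eval_map,
      ← aeval_def]
  have hroot : ∀ h : K ≃ₐ[RatFunc C] K, F.eval₂ ev (h y) = 0 := by
    intro h
    have := congrArg h hF
    rw [map_zero, ← AlgEquiv.coe_ringEquiv, ← RingEquiv.coe_toRingHom, hom_eval₂] at this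
    rw [← this]
    congr 1
    refine ringHom_ext (fun c => ?_) ?_
    · simp [hev, galois_algebraMap]
    · simp [hev, x]
  have hreg : ∀ h : K ≃ₐ[RatFunc C] K, p.ring.valuation (h y) ≤ 1 := by
    intro h
    by_contra! hlt
    have h1 := congrArg (eval₂ ev (h y)) hW
    rw [eval₂_mul, hroot, mul_zero, eval₂_add, eval₂_mul, eval₂_C, eval₂_pow, eval₂_X] at h1
    have hpos : p.ring.valuation (h y) ^ m ≠ 0 := pow_ne_zero _ (zero_lt_one.trans hlt).ne'
    have h2 : p.ring.valuation (G.eval₂ ev (h y)) < p.ring.valuation (h y) ^ m := by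
      rw [eval₂_eq_sum, Polynomial.sum]
      refine Valuation.map_sum_lt _ hpos fun i hi => ?_
      rw [map_mul, map_pow]
      refine (mul_le_of_le_one_left' (hevreg _)).trans_lt (pow_lt_pow_right₀ hlt ?_)
      exact_mod_cast (le_degree_of_mem_supp i hi).trans_lt hG
    have h3 : G.eval₂ ev (h y) = -(ev D * h y ^ m) := by linear_combination -h1
    rw [h3, Valuation.map_neg, map_mul, map_pow, hevD, one_mul] at h2
    exact h2.false
  refine ⟨hreg, fun h hh => ?_⟩
  by_contra! hlt
  have hne : h y - y ≠ 0 := by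
    intro h0
    refine hh (AlgEquiv.ext fun z => ?_)
    have := IntermediateField.algHom_ext_of_eq_adjoin (F := RatFunc C) (K := K) hy.symm
      (φ₁ := h.toAlgHom.comp (IntermediateField.val ⊤)) (φ₂ := IntermediateField.val ⊤)
      fun z hz => by
        obtain rfl := Set.mem_singleton_iff.mp hz
        exact sub_eq_zero.mp h0
    exact congrArg (fun φ => φ ⟨z, IntermediateField.mem_top⟩) this
  -- the Taylor expansion of `F` at `y`, over the local ring of `p`
  let evO : k[X] →+* p.ring := ev.codRestrict p.ring.toSubring fun d =>
    (p.ring.valuation_le_one_iff _).mp (hevreg d)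
  have hevO : (algebraMap p.ring K).comp evO = ev := RingHom.ext fun _ => rfl
  have hyO : y ∈ p.ring := (p.ring.valuation_le_one_iff _).mp (hreg 1)
  have hdO : h y - y ∈ p.ring := (p.ring.valuation_le_one_iff _).mp hlt.le
  obtain ⟨q, hq⟩ := binomExpansion (F.map evO) ⟨y, hyO⟩ ⟨h y - y, hdO⟩
  have hev2 : ∀ (P : k[X][X]) (z : p.ring), algebraMap p.ring K ((P.map evO).eval z) =
      P.eval₂ ev (z : K) := by
    intro P z
    rw [eval_map, hom_eval₂, hevO]
    rfl
  have hder : (derivative F).eval₂ ev y = -(q * (h y - y)) := by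
    have := congrArg (algebraMap p.ring K) hq
    rw [map_add, map_add, map_mul, map_mul, map_pow, derivative_map, hev2, hev2, hev2] at this
    have h1 : (((⟨y, hyO⟩ : p.ring) + ⟨h y - y, hdO⟩ : p.ring) : K) = h y := add_sub_cancel y (h y)
    rw [h1, hroot, hF, zero_add] at this
    refine mul_right_cancel₀ hne ?_
    change 0 = (derivative F).eval₂ ev y * (h y - y) + (q : K) * (h y - y) ^ 2 at this
    linear_combination -this
  have hfin := congrArg (eval₂ ev y) hUV
  rw [eval₂_add, eval₂_mul, eval₂_mul, hF, mul_zero, zero_add, eval₂_C, hder] at hfin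
  have hV : p.ring.valuation (V.eval₂ ev y) ≤ 1 := by
    have := p.ring.valuation_le_one ((V.map evO).eval ⟨y, hyO⟩)
    rwa [← ValuationSubring.algebraMap_apply, hev2] at this
  rw [← hfin, map_mul, Valuation.map_neg, map_mul] at hevD
  refine hevD.not_lt ((mul_le_of_le_one_left' hV).trans_lt ?_)
  exact (mul_le_of_le_one_left' (p.ring.valuation_le_one q)).trans_lt hlt


/-- An equation of the covering is separable over `k(x)`: over `C(x)` it is, up to a constant, the
minimal polynomial of a primitive element. -/
theorem IsEquation.separable [IsScalarTower C (RatFunc C) K] [FiniteDimensional (RatFunc C) K]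
    [IsGalois (RatFunc C) K] {F : k[X][X]} (hF : IsEquation (C := C) (K := K) F) :
    (F.map (algebraMap k[X] (RatFunc k))).Separable := by
  obtain ⟨y, hy, hFy, hn⟩ := hF
  have hinj : Function.Injective
      ((algebraMap C[X] (RatFunc C)).comp (mapRingHom (algebraMap k C))) :=
    (RatFunc.algebraMap_injective C).comp (map_injective _ (algebraMap k C).injective)
  let j : RatFunc k →+* RatFunc C := IsFractionRing.lift hinj
  have hj : j.comp (algebraMap k[X] (RatFunc k)) =
      (algebraMap C[X] (RatFunc C)).comp (mapRingHom (algebraMap k C)) :=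
    RingHom.ext fun d => IsFractionRing.lift_algebraMap hinj d
  rw [← separable_map j, Polynomial.map_map, hj]
  set FC := F.map ((algebraMap C[X] (RatFunc C)).comp (mapRingHom (algebraMap k C))) with hFC
  have hdeg : FC.natDegree = Module.finrank (RatFunc C) K := by
    rw [hFC, natDegree_map_eq_of_injective hinj, hn]
  have hroot : aeval y FC = 0 := by
    rw [aeval_def, hFC, eval₂_map, ← hFy]
    congr 1
    refine ringHom_ext (fun c => ?_) ?_
    · simp [IsScalarTower.algebraMap_apply C (RatFunc C) K, RatFunc.algebraMap_eq_C]
    · simp [x]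
  have hint : IsIntegral (RatFunc C) y := IsIntegral.of_finite _ _
  have hmin : (minpoly (RatFunc C) y).natDegree = Module.finrank (RatFunc C) K := by
    rw [← IntermediateField.adjoin.finrank hint, hy, IntermediateField.finrank_top']
  have hFC0 : FC ≠ 0 := by
    intro h0
    rw [h0, natDegree_zero] at hdeg
    exact Module.finrank_pos.ne hdeg
  rw [eq_leadingCoeff_mul_of_monic_of_dvd_of_natDegree_le (minpoly.monic hint)
    (minpoly.dvd _ _ hroot) (hdeg.trans hmin.symm).le]
  refine Separable.unit_mul (isUnit_C.mpr ?_) (Algebra.IsSeparable.isSeparable _ _)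
  exact (leadingCoeff_ne_zero.mpr hFC0).isUnit

/-- Over an algebraically closed field, the bad fibres are controlled by a product of linear
factors: a common denominator of Bezout coefficients for `F` and `∂F/∂y`, times the leading
coefficient of `F`. -/
theorem exists_controlsFibres_of_separable [IsAlgClosed k] {F : k[X][X]}
    (hn : F.natDegree ≠ 0) (hF : (F.map (algebraMap k[X] (RatFunc k))).Separable) :
    ∃ L : List k, ControlsFibres F (L.map fun a => X - Polynomial.C a).prod := by
  have hinj := RatFunc.algebraMap_injective k
  have hF0 : F ≠ 0 := by
    rintro rfl
    simp at hn
  obtain ⟨a, b, hab⟩ := hF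
  obtain ⟨d, hd, hda⟩ := IsLocalization.integerNormalization_spec (nonZeroDivisors k[X]) a
  obtain ⟨e, he, heb⟩ := IsLocalization.integerNormalization_spec (nonZeroDivisors k[X]) b
  set A := IsLocalization.integerNormalization (nonZeroDivisors k[X]) a
  set B := IsLocalization.integerNormalization (nonZeroDivisors k[X]) b
  have hbez : Polynomial.C e * A * F + Polynomial.C d * B * derivative F =
      Polynomial.C (d * e) := by
    apply map_injective _ hinj
    simp only [Polynomial.map_add, Polynomial.map_mul, hda, heb, Polynomial.map_C,
      ← derivative_map, map_mul]
    rw [Algebra.smul_def, Algebra.smul_def, Polynomial.algebraMap_apply,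
      Polynomial.algebraMap_apply]
    linear_combination (Polynomial.C (algebraMap k[X] (RatFunc k) d) *
      Polynomial.C (algebraMap k[X] (RatFunc k) e)) * hab
  set D := d * e * F.leadingCoeff with hD
  have hD0 : D ≠ 0 := mul_ne_zero (mul_ne_zero (nonZeroDivisors.ne_zero hd)
    (nonZeroDivisors.ne_zero he)) (leadingCoeff_ne_zero.mpr hF0)
  refine ⟨D.roots.toList, ?_⟩
  have hprod : (D.roots.toList.map fun a => X - Polynomial.C a).prod =
      Polynomial.C D.leadingCoeff⁻¹ * D := by
    have hmul : (D.roots.toList.map fun a => X - Polynomial.C a).prod =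
        (D.roots.map fun a => X - Polynomial.C a).prod := by
      conv_rhs => rw [← Multiset.coe_toList D.roots, Multiset.map_coe, Multiset.prod_coe]
    have hc : Polynomial.C D.leadingCoeff⁻¹ * Polynomial.C D.leadingCoeff = 1 := by
      rw [← C_mul, inv_mul_cancel₀ (leadingCoeff_ne_zero.mpr hD0), C_1]
    rw [hmul]
    linear_combination (-Polynomial.C D.leadingCoeff⁻¹) * (IsAlgClosed.splits D).eq_prod_roots -
      (D.roots.map fun a => X - Polynomial.C a).prod * hc
  rw [hprod]
  refine ⟨⟨Polynomial.C (Polynomial.C D.leadingCoeff⁻¹ * F.leadingCoeff) * (Polynomial.C e * A),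
    Polynomial.C (Polynomial.C D.leadingCoeff⁻¹ * F.leadingCoeff) * (Polynomial.C d * B), ?_⟩,
    Polynomial.C (Polynomial.C D.leadingCoeff⁻¹ * (d * e)),
    Polynomial.C (Polynomial.C D.leadingCoeff⁻¹ * (d * e)) * F.eraseLead, F.natDegree, ?_, ?_⟩
  · rw [hD]
    simp only [C_mul] at hbez ⊢
    linear_combination (Polynomial.C (Polynomial.C D.leadingCoeff⁻¹) *
      Polynomial.C F.leadingCoeff) * hbez
  · rw [← smul_eq_C_mul]
    exact (degree_smul_le _ _).trans_lt ((degree_eraseLead_lt hF0).trans_le degree_le_natDegree)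
  · conv_lhs => rw [← eraseLead_add_C_mul_X_pow F]
    rw [hD]
    simp only [C_mul]
    ring

theorem IsEquation.exists_controlsFibres [IsAlgClosed k] [IsScalarTower C (RatFunc C) K]
    [FiniteDimensional (RatFunc C) K] [IsGalois (RatFunc C) K] {F : k[X][X]}
    (hF : IsEquation (C := C) (K := K) F) :
    ∃ L : List k, ControlsFibres F (L.map fun a => X - Polynomial.C a).prod := by
  refine exists_controlsFibres_of_separable ?_ hF.separable
  obtain ⟨_, _, _, hn⟩ := hF
  rw [hn]
  exact Module.finrank_pos.ne'

variable (C K) in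
theorem exists_isEquation [IsScalarTower C (RatFunc C) K]
    [FiniteDimensional (RatFunc C) K] [IsGalois (RatFunc C) K] :
    ∃ F : C[X][X], IsEquation (C := C) (K := K) F := by
  obtain ⟨y, hy⟩ := Field.exists_primitive_element (RatFunc C) K
  obtain ⟨d, hd, hF⟩ := IsLocalization.integerNormalization_spec (nonZeroDivisors C[X])
    (minpoly (RatFunc C) y)
  set F := IsLocalization.integerNormalization (nonZeroDivisors C[X]) (minpoly (RatFunc C) y)
  refine ⟨F, y, hy, ?_, ?_⟩
  · have h : eval₂RingHom ((algebraMap C K).comp (algebraMap C C)) (x C K) =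
        (algebraMap (RatFunc C) K).comp (algebraMap C[X] (RatFunc C)) := by
      refine ringHom_ext (fun c => ?_) ?_
      · simp [IsScalarTower.algebraMap_apply C (RatFunc C) K, RatFunc.algebraMap_eq_C]
      · simp [x]
    rw [h, ← eval₂_map, hF, ← aeval_def, Algebra.smul_def, map_mul, minpoly.aeval, mul_zero]
  · rw [← natDegree_map_eq_of_injective (RatFunc.algebraMap_injective C), hF,
      ← algebraMap_smul (RatFunc C) d, smul_eq_C_mul,
      natDegree_C_mul ((map_ne_zero_iff _ (RatFunc.algebraMap_injective C)).mpr
        (nonZeroDivisors.ne_zero hd)),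
      ← IntermediateField.adjoin.finrank (IsIntegral.of_finite _ _), hy,
      IntermediateField.finrank_top']

/-- The zeros of a polynomial that controls the bad fibres, together with infinity, form an
exceptional set. -/
theorem ControlsFibres.isExceptionalSet [IsAlgClosed C] [IsScalarTower C (RatFunc C) K]
    [FiniteDimensional (RatFunc C) K] (ι : C →+* ℂ) {F : k[X][X]} {L : List k}
    (hF : IsEquation (C := C) (K := K) F)
    (hL : ControlsFibres F (L.map fun a => X - Polynomial.C a).prod) :
    IsExceptionalSet.{u, v, w} ι K
      {q | ∃ c ∈ (none :: L.map some : List (Option k)), toLine c = q} := by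
  obtain ⟨y, hy, hFy, -⟩ := hF
  refine isExceptionalSet_of_separatesFibre ι (y := y) ⟨none, by simp, rfl⟩
    fun q b hb hx => hL.separatesFibre hy hFy q hx fun h0 => hb ?_
  rw [map_list_prod, List.prod_eq_zero_iff, List.map_map, List.mem_map] at h0
  obtain ⟨a, ha, hab⟩ := h0
  refine ⟨some a, by simpa using ha, ?_⟩
  have : b = algebraMap k C a := sub_eq_zero.mp (by simpa using hab)
  rw [this]
  rfl

end Covering

/-! ### Computable polynomial arithmetic -/

namespace Computable

variable {α β σ : Type*} [Primcodable α] [Primcodable β] [Primcodable σ]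

theorem list_foldl {f : α → List β} {g : α → σ} {h : α → σ × β → σ} (hf : Computable f)
    (hg : Computable g) (hh : Computable₂ h) :
    Computable fun a => (f a).foldl (fun s b => h a (s, b)) (g a) := by
  have hstep : Computable₂ fun (a : α) (q : ℕ × σ) =>
      (Option.casesOn ((f a)[q.1]?) q.2 fun b => h a (q.2, b) : σ) := by
    refine option_casesOn ?_ (snd.comp snd) ?_
    · exact list_getElem?.comp (hf.comp fst) (fst.comp snd)
    · exact hh.comp (fst.comp fst) (pair (snd.comp (snd.comp fst)) snd)
  refine (nat_rec (list_length.comp hf) hg hstep).of_eq fun a => ?_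
  suffices H : ∀ n ≤ (f a).length, (Nat.rec (g a) (fun y IH =>
      (Option.casesOn ((f a)[y]?) IH fun b => h a (IH, b) : σ)) n : σ) =
        ((f a).take n).foldl (fun s b => h a (s, b)) (g a) by
    have := H _ le_rfl
    rwa [List.take_length] at this
  intro n hn
  induction n with
  | zero => rfl
  | succ n ih =>
    have ih := ih (by omega)
    simp only [ih]
    rw [List.take_add_one, List.getElem?_eq_getElem (by omega), Option.toList_some,
      List.foldl_append]
    rfl

theorem list_foldr {f : α → List β} {g : α → σ} {h : α → β × σ → σ} (hf : Computable f)
    (hg : Computable g) (hh : Computable₂ h) :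
    Computable fun a => (f a).foldr (fun b s => h a (b, s)) (g a) := by
  have hh' : Computable₂ fun (a : α) (q : σ × β) => h a (q.2, q.1) :=
    hh.comp fst (pair (snd.comp snd) (fst.comp snd))
  refine (list_foldl (list_reverse.comp hf) hg hh').of_eq fun a => ?_
  rw [List.foldl_reverse]

theorem list_map {f : α → List β} {g : α → β → σ} (hf : Computable f) (hg : Computable₂ g) :
    Computable fun a => (f a).map (g a) := by
  have h : Computable₂ fun (a : α) (q : β × List σ) => g a q.1 :: q.2 :=
    list_cons.comp (hg.comp fst (fst.comp snd)) (snd.comp snd)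
  refine (list_foldr hf (const []) h).of_eq fun a => ?_
  induction f a with
  | nil => rfl
  | cons b l ih => rw [List.foldr_cons, ih, List.map_cons]

end Computable

namespace Covering

open Polynomial

section

variable {R : Type*} [CommRing R]

@[simp]
theorem ofCoeffs_nil : ofCoeffs ([] : List R) = 0 := rfl

@[simp]
theorem ofCoeffs_cons (a : R) (l : List R) : ofCoeffs (a :: l) = C a + X * ofCoeffs l := rfl

theorem coeff_ofCoeffs (l : List R) (n : ℕ) : (ofCoeffs l).coeff n = l.getD n 0 := by
  induction l generalizing n with
  | nil => simp
  | cons a l ih =>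
    cases n with
    | zero => simp
    | succ n => simp [ih]

theorem ofCoeffs_append_singleton (l : List R) (a : R) :
    ofCoeffs (l ++ [a]) = ofCoeffs l + C a * X ^ l.length := by
  induction l with
  | nil => simp
  | cons b l ih =>
    rw [List.cons_append, ofCoeffs_cons, ih, ofCoeffs_cons, List.length_cons]
    ring

theorem degree_ofCoeffs_lt (l : List R) : (ofCoeffs l).degree < l.length := by
  rw [degree_lt_iff_coeff_zero]
  intro n hn
  rw [coeff_ofCoeffs, List.getD_eq_default _ _ hn]

end

/-- A computable presentation of a commutative ring `R`: codes for all of its elements, and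
algorithms for the ring operations and for the equality of the elements with given codes. An element
may have several codes. -/
structure RingPresentation (α : Type*) [Primcodable α] (R : Type*) [CommRing R] where
  /-- The element with a given code. -/
  val : α → R
  val_surjective : Function.Surjective val
  /-- A code of zero. -/
  zero : α
  val_zero : val zero = 0
  /-- Addition of codes. -/
  add : α → α → α
  val_add : ∀ a b, val (add a b) = val a + val b
  computable_add : Computable₂ add
  /-- Multiplication of codes. -/
  mul : α → α → α
  val_mul : ∀ a b, val (mul a b) = val a * val b
  computable_mul : Computable₂ mul
  /-- The test for equality of elements. -/
  eqv : α → α → Bool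
  eqv_iff : ∀ a b, eqv a b = true ↔ val a = val b
  computable_eqv : Computable₂ eqv

namespace RingPresentation

variable {α : Type*} [Primcodable α] {R : Type*} [CommRing R] (P : RingPresentation α R)

/-- The sum of two lists of coefficients of possibly different lengths. -/
def listAdd (l m : List α) : List α :=
  (List.range (l.length + m.length)).map fun i => P.add (l.getD i P.zero) (m.getD i P.zero)

/-- The product of two polynomials, given by their coefficients, by the rule
`(a + X p) q = a q + X (p q)`. -/
def listMul (l m : List α) : List α :=
  l.foldr (fun a q => P.listAdd (m.map fun b => P.mul a b) (P.zero :: q)) []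

/-- The test for equality of two polynomials, which ignores zeros at the end of the lists of their
coefficients. -/
def listEqv (l m : List α) : Bool :=
  (List.range (l.length + m.length)).foldr
    (fun i b => P.eqv (l.getD i P.zero) (m.getD i P.zero) && b) true

/-- The derivative of a list of coefficients, by the rule `(a + X q)' = q + X q'`. -/
def listDerivative (l : List α) : List α :=
  (l.foldr (fun a q => (a :: q.1, P.listAdd q.1 (P.zero :: q.2))) (([], []) : List α × List α)).2

theorem computable_getD (d : α) : Computable₂ fun (l : List α) n => l.getD n d :=
  (Primrec.list_getD d).to_comp

theorem computable_listAdd : Computable₂ P.listAdd := by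
  have hlen : Computable fun q : List α × List α => List.range (q.1.length + q.2.length) :=
    Primrec.list_range.to_comp.comp (Primrec.nat_add.to_comp.comp
      (Computable.list_length.comp Computable.fst) (Computable.list_length.comp Computable.snd))
  refine Computable.list_map hlen (P.computable_add.comp ?_ ?_)
  · exact (computable_getD P.zero).comp (Computable.fst.comp Computable.fst) Computable.snd
  · exact (computable_getD P.zero).comp (Computable.snd.comp Computable.fst) Computable.snd

theorem computable_listMul : Computable₂ P.listMul := by
  refine Computable.list_foldr (f := fun q : List α × List α => q.1) (g := fun _ => [])
    (h := fun q s => P.listAdd (q.2.map fun b => P.mul s.1 b) (P.zero :: s.2))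
    Computable.fst (Computable.const _) (P.computable_listAdd.comp ?_ ?_)
  · exact Computable.list_map (Computable.snd.comp Computable.fst)
      (P.computable_mul.comp (Computable.fst.comp (Computable.snd.comp Computable.fst))
        Computable.snd)
  · exact Computable.list_cons.comp (Computable.const _) (Computable.snd.comp Computable.snd)

theorem computable_listEqv : Computable₂ P.listEqv := by
  have hlen : Computable fun q : List α × List α => List.range (q.1.length + q.2.length) :=
    Primrec.list_range.to_comp.comp (Primrec.nat_add.to_comp.comp
      (Computable.list_length.comp Computable.fst) (Computable.list_length.comp Computable.snd))
  have hstep : Computable₂ fun (q : List α × List α) (s : ℕ × Bool) =>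
      P.eqv (q.1.getD s.1 P.zero) (q.2.getD s.1 P.zero) && s.2 := by
    refine Primrec.and.to_comp.comp (P.computable_eqv.comp ?_ ?_)
      (Computable.snd.comp Computable.snd)
    · exact (computable_getD P.zero).comp (Computable.fst.comp Computable.fst)
        (Computable.fst.comp Computable.snd)
    · exact (computable_getD P.zero).comp (Computable.snd.comp Computable.fst)
        (Computable.fst.comp Computable.snd)
  exact Computable.list_foldr hlen (Computable.const true) hstep

theorem computable_listDerivative : Computable P.listDerivative := by
  refine Computable.snd.comp (Computable.list_foldr (f := fun l : List α => l)
    (g := fun _ => (([], []) : List α × List α))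
    (h := fun _ q => (q.1 :: q.2.1, P.listAdd q.2.1 (P.zero :: q.2.2)))
    Computable.id (Computable.const _) (Computable.pair ?_ (P.computable_listAdd.comp ?_ ?_)))
  · exact Computable.list_cons.comp (Computable.fst.comp Computable.snd)
      (Computable.fst.comp (Computable.snd.comp Computable.snd))
  · exact Computable.fst.comp (Computable.snd.comp Computable.snd)
  · exact Computable.list_cons.comp (Computable.const _)
      (Computable.snd.comp (Computable.snd.comp Computable.snd))

/-- The polynomial with a given list of codes of coefficients. -/
def listVal (l : List α) : R[X] :=
  ofCoeffs (l.map P.val)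

@[simp]
theorem listVal_nil : P.listVal [] = 0 := rfl

@[simp]
theorem listVal_cons (a : α) (l : List α) :
    P.listVal (a :: l) = C (P.val a) + X * P.listVal l := rfl

theorem coeff_listVal (l : List α) (n : ℕ) : (P.listVal l).coeff n = P.val (l.getD n P.zero) := by
  rw [listVal, coeff_ofCoeffs, ← P.val_zero, List.getD_map]

theorem listVal_add (l m : List α) : P.listVal (P.listAdd l m) = P.listVal l + P.listVal m := by
  ext n
  rw [coeff_add, coeff_listVal, coeff_listVal, coeff_listVal, ← P.val_add]
  by_cases hn : n < l.length + m.length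
  · simp [listAdd, List.getD_eq_getElem?_getD, hn]
  · rw [List.getD_eq_default (l := P.listAdd l m) _ (by simpa [listAdd] using hn),
      List.getD_eq_default (l := l) _ (by omega), List.getD_eq_default (l := m) _ (by omega),
      P.val_add, P.val_zero, add_zero]

theorem listVal_map_mul (a : α) (l : List α) :
    P.listVal (l.map fun b => P.mul a b) = C (P.val a) * P.listVal l := by
  induction l with
  | nil => simp
  | cons b l ih =>
    rw [List.map_cons, listVal_cons, ih, listVal_cons, P.val_mul, C_mul]
    ring

theorem listVal_mul (l m : List α) : P.listVal (P.listMul l m) = P.listVal l * P.listVal m := by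
  induction l with
  | nil => simp [listMul]
  | cons a l ih =>
    have : P.listMul (a :: l) m =
        P.listAdd (m.map fun b => P.mul a b) (P.zero :: P.listMul l m) := rfl
    rw [this, listVal_add, listVal_map_mul, listVal_cons, ih, P.val_zero, listVal_cons, C_0]
    ring

theorem listVal_derivative (l : List α) :
    P.listVal (P.listDerivative l) = derivative (P.listVal l) := by
  suffices H : P.listVal (l.foldr (fun a q => (a :: q.1, P.listAdd q.1 (P.zero :: q.2)))
      (([], []) : List α × List α)).1 = P.listVal l ∧
      P.listVal (P.listDerivative l) = derivative (P.listVal l) from H.2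
  induction l with
  | nil => simp [listDerivative]
  | cons a l ih =>
    refine ⟨by rw [List.foldr_cons, listVal_cons, ih.1, listVal_cons], ?_⟩
    rw [listDerivative, List.foldr_cons, listVal_add, ih.1, listVal_cons]
    change P.listVal l + (C (P.val P.zero) + X * P.listVal (P.listDerivative l)) = _
    rw [ih.2, P.val_zero]
    simp

theorem listEqv_iff (l m : List α) : P.listEqv l m = true ↔ P.listVal l = P.listVal m := by
  have h1 : ∀ (s : List ℕ) (f : ℕ → Bool),
      s.foldr (fun i b => f i && b) true = true ↔ ∀ i ∈ s, f i = true := by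
    intro s f
    induction s with
    | nil => simp
    | cons a s ih => simp [ih]
  rw [listEqv, h1]
  constructor
  · intro h
    ext n
    rw [coeff_listVal, coeff_listVal]
    by_cases hn : n < l.length + m.length
    · exact (P.eqv_iff _ _).mp (h n (List.mem_range.mpr hn))
    · rw [List.getD_eq_default (l := l) _ (by omega), List.getD_eq_default (l := m) _ (by omega)]
  · intro h i _
    rw [P.eqv_iff, ← coeff_listVal, ← coeff_listVal, h]

theorem exists_listVal_eq {p : R[X]} {n : ℕ} (hp : p.degree < n) :
    ∃ l : List α, l.length = n ∧ P.listVal l = p := by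
  refine ⟨(List.range n).map fun i => Function.surjInv P.val_surjective (p.coeff i), by simp, ?_⟩
  ext i
  rw [coeff_listVal]
  by_cases hi : i < n
  · simp [List.getD_eq_getElem?_getD, hi, Function.surjInv_eq]
  · rw [List.getD_eq_default _ _ (by simpa using hi), P.val_zero]
    exact ((degree_lt_iff_coeff_zero p n).mp hp i (not_lt.mp hi)).symm

/-- The presentation of a polynomial ring by lists of coefficients. -/
def list : RingPresentation (List α) R[X] where
  val := P.listVal
  val_surjective p := by
    obtain ⟨l, -, hl⟩ := P.exists_listVal_eq (degree_le_natDegree.trans_lt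
      (Nat.cast_lt.mpr p.natDegree.lt_succ_self))
    exact ⟨l, hl⟩
  zero := []
  val_zero := rfl
  add := P.listAdd
  val_add := P.listVal_add
  computable_add := P.computable_listAdd
  mul := P.listMul
  val_mul := P.listVal_mul
  computable_mul := P.computable_listMul
  eqv := P.listEqv
  eqv_iff := P.listEqv_iff
  computable_eqv := P.computable_listEqv

end RingPresentation

end Covering

/-! ### The search for a certificate -/

namespace Covering

open Polynomial

namespace RingPresentation

/-- A field with a computable addition and multiplication, each element having one code, itself. -/
def ofField {k : Type*} [Field k] [Primcodable k] (hadd : Computable₂ fun a b : k => a + b)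
    (hmul : Computable₂ fun a b : k => a * b) : RingPresentation k k where
  val := id
  val_surjective := Function.surjective_id
  zero := 0
  val_zero := rfl
  add a b := a + b
  val_add _ _ := rfl
  computable_add := hadd
  mul a b := a * b
  val_mul _ _ := rfl
  computable_mul := hmul
  eqv a b := Encodable.encode a == Encodable.encode b
  eqv_iff a b := by simp
  computable_eqv := (Primrec.beq (α := ℕ)).to_comp.comp
    (Computable.encode.comp Computable.fst) (Computable.encode.comp Computable.snd)

variable {α : Type*} [Primcodable α] {k : Type*} [Field k] (P : RingPresentation α k)

/-- A code of a constant. -/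
def code (c : k) : α := Function.surjInv P.val_surjective c

theorem val_code (c : k) : P.val (P.code c) = c := Function.surjInv_eq _ _

/-- The product of the linear factors `X - a` for `a` in a list. -/
def listLinearProd (L : List α) : List α :=
  L.foldr (fun a q => P.listMul [P.mul (P.code (-1)) a, P.code 1] q) [P.code 1]

theorem listVal_linearProd (L : List α) :
    P.listVal (P.listLinearProd L) = ((L.map P.val).map fun a => X - C a).prod := by
  induction L with
  | nil => simp [listLinearProd, val_code]
  | cons a L ih =>
    have h : P.listLinearProd (a :: L) =
        P.listMul [P.mul (P.code (-1)) a, P.code 1] (P.listLinearProd L) := rfl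
    rw [h, listVal_mul, ih, List.map_cons, List.map_cons, List.prod_cons]
    congr 1
    simp [P.val_mul, val_code]
    ring

theorem computable_listLinearProd : Computable P.listLinearProd := by
  have h1 : Computable fun q : α × List α => P.mul (P.code (-1)) q.1 :=
    P.computable_mul.comp (Computable.const _) Computable.fst
  have h2 : Computable fun q : α × List α =>
      [P.mul (P.code (-1)) q.1, P.code 1] :=
    Computable.list_cons.comp h1 (Computable.const _)
  have h3 : Computable fun q : α × List α =>
      P.listMul [P.mul (P.code (-1)) q.1, P.code 1] q.2 :=
    P.computable_listMul.comp h2 Computable.snd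
  have h4 : Computable₂ fun (_ : List α) (s : α × List α) =>
      P.listMul [P.mul (P.code (-1)) s.1, P.code 1] s.2 := h3.comp Computable.snd
  exact Computable.list_foldr (f := fun L : List α => L) (g := fun _ => [P.code 1])
    (h := fun _ s => P.listMul [P.mul (P.code (-1)) s.1, P.code 1] s.2)
    Computable.id (Computable.const [P.code 1]) h4

/-- A proof that the linear factors of a list control the bad fibres of `F(x, y) = 0`: the
polynomials `U`, `V`, `W`, `G` of `ControlsFibres`, and the list. -/
abbrev Certificate (α : Type*) : Type _ :=
  List (List α) × List (List α) × List (List α) × List (List α) × List α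

/-- The verification of a certificate. -/
def certifies (F : List (List α)) (c : Certificate α) : Bool :=
  P.list.listEqv (P.list.listAdd (P.list.listMul c.1 F)
      (P.list.listMul c.2.1 (P.list.listDerivative F))) [P.listLinearProd c.2.2.2.2] &&
    P.list.listEqv (P.list.listMul c.2.2.1 F) (c.2.2.2.1 ++ [P.listLinearProd c.2.2.2.2])

theorem computable_certifies : Computable₂ P.certifies := by
  have hD : Computable fun q : List (List α) × Certificate α => P.listLinearProd q.2.2.2.2.2 :=
    P.computable_listLinearProd.comp (Computable.snd.comp (Computable.snd.comp (Computable.snd.comp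
      (Computable.snd.comp Computable.snd))))
  have hD' : Computable fun q : List (List α) × Certificate α =>
      [P.listLinearProd q.2.2.2.2.2] :=
    Computable.list_cons.comp hD (Computable.const _)
  have h1 : Computable fun q : List (List α) × Certificate α => P.list.listMul q.2.1 q.1 :=
    P.list.computable_listMul.comp (Computable.fst.comp Computable.snd) Computable.fst
  have h2 : Computable fun q : List (List α) × Certificate α =>
      P.list.listMul q.2.2.1 (P.list.listDerivative q.1) :=
    P.list.computable_listMul.comp (Computable.fst.comp (Computable.snd.comp Computable.snd))
      (P.list.computable_listDerivative.comp Computable.fst)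
  have h3 : Computable fun q : List (List α) × Certificate α => P.list.listMul q.2.2.2.1 q.1 :=
    P.list.computable_listMul.comp (Computable.fst.comp (Computable.snd.comp
      (Computable.snd.comp Computable.snd))) Computable.fst
  have h4 : Computable fun q : List (List α) × Certificate α => q.2.2.2.2.1 :=
    Computable.fst.comp (Computable.snd.comp (Computable.snd.comp
      (Computable.snd.comp Computable.snd)))
  exact Primrec.and.to_comp.comp
    (P.list.computable_listEqv.comp (P.list.computable_listAdd.comp h1 h2) hD')
    (P.list.computable_listEqv.comp h3 (Computable.list_append.comp h4 hD'))

theorem certifies_iff (F : List (List α)) (c : Certificate α) :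
    P.certifies F c = true ↔
      P.list.listVal c.1 * P.list.listVal F +
        P.list.listVal c.2.1 * derivative (P.list.listVal F) =
          C ((c.2.2.2.2.map P.val).map fun a => X - C a).prod ∧
      P.list.listVal c.2.2.1 * P.list.listVal F = P.list.listVal c.2.2.2.1 +
        C ((c.2.2.2.2.map P.val).map fun a => X - C a).prod * X ^ c.2.2.2.1.length := by
  have h1 : P.list.listVal [P.listLinearProd c.2.2.2.2] =
      C ((c.2.2.2.2.map P.val).map fun a => X - C a).prod := by
    rw [listVal_cons, ← listVal_linearProd, listVal_nil, mul_zero, add_zero]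
    rfl
  have h2 : P.list.listVal (c.2.2.2.1 ++ [P.listLinearProd c.2.2.2.2]) =
      P.list.listVal c.2.2.2.1 +
        C ((c.2.2.2.2.map P.val).map fun a => X - C a).prod * X ^ c.2.2.2.1.length := by
    rw [listVal, List.map_append, List.map_singleton, ofCoeffs_append_singleton, List.length_map,
      ← listVal_linearProd]
    rfl
  rw [certifies, Bool.and_eq_true, listEqv_iff, listEqv_iff, listVal_add, listVal_mul,
    listVal_mul, listVal_mul, listVal_derivative, h1, h2]

theorem controlsFibres_of_certifies {F : List (List α)} {c : Certificate α}
    (h : P.certifies F c = true) :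
    ControlsFibres (P.list.listVal F) ((c.2.2.2.2.map P.val).map fun a => X - C a).prod := by
  obtain ⟨h1, h2⟩ := (P.certifies_iff F c).mp h
  refine ⟨⟨_, _, h1⟩, _, _, _, ?_, h2⟩
  simpa [listVal] using degree_ofCoeffs_lt (c.2.2.2.1.map P.list.val)

theorem exists_certifies {F : List (List α)} {L : List k}
    (h : ControlsFibres (P.list.listVal F) (L.map fun a => X - C a).prod) :
    ∃ c : Certificate α, P.certifies F c = true := by
  obtain ⟨⟨U, V, hUV⟩, W, G, m, hG, hW⟩ := h
  obtain ⟨u, rfl⟩ := P.list.list.val_surjective U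
  obtain ⟨v, rfl⟩ := P.list.list.val_surjective V
  obtain ⟨w, rfl⟩ := P.list.list.val_surjective W
  obtain ⟨g, rfl, rfl⟩ := P.list.exists_listVal_eq hG
  obtain ⟨l, rfl⟩ := List.map_surjective_iff.mpr P.val_surjective L
  exact ⟨(u, v, w, g, l), (P.certifies_iff _ _).mpr ⟨hUV, hW⟩⟩

/-- The algorithm that searches for a certificate. Its output consists of the point at
infinity and of the zeros listed in the first certificate that it finds. -/
def search (F : List (List α)) : Part (List (Option α)) :=
  Nat.rfindOpt fun n => (Encodable.decode (α := Certificate α) n).bind fun c =>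
    bif P.certifies F c then some (none :: c.2.2.2.2.map some) else none

theorem partrec_search : Partrec P.search := by
  refine Partrec.rfindOpt (Computable.option_bind (Computable.decode.comp Computable.snd)
    (Computable.cond (P.computable_certifies.comp (Computable.fst.comp Computable.fst)
      Computable.snd) (Computable.option_some.comp (Computable.list_cons.comp
        (Computable.const _) (Computable.list_map ?_ ?_))) (Computable.const _)))
  · exact Computable.snd.comp (Computable.snd.comp (Computable.snd.comp
      (Computable.snd.comp Computable.snd)))
  · exact Computable.option_some.comp Computable.snd

theorem exists_mem_search {F : List (List α)} {L : List k}
    (h : ControlsFibres (P.list.listVal F) (L.map fun a => X - C a).prod) :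
    ∃ l : List α, (none :: l.map some) ∈ P.search F ∧
      ControlsFibres (P.list.listVal F) ((l.map P.val).map fun a => X - C a).prod := by
  obtain ⟨c, hc⟩ := P.exists_certifies h
  have hdom : (P.search F).Dom := by
    rw [search, Nat.rfindOpt_dom]
    exact ⟨Encodable.encode c, none :: c.2.2.2.2.map some, by simp [hc]⟩
  obtain ⟨n, hn⟩ := Nat.rfindOpt_spec (Part.get_mem hdom)
  obtain ⟨d, hd, hdn⟩ := Option.bind_eq_some_iff.mp hn
  by_cases hF : P.certifies F d = true
  · rw [hF, cond_true, Option.some_inj] at hdn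
    refine ⟨d.2.2.2.2, ?_, P.controlsFibres_of_certifies hF⟩
    rw [hdn]
    exact Part.get_mem hdom
  · rw [Bool.not_eq_true] at hF
    rw [hF, cond_false] at hdn
    cases hdn

end RingPresentation

end Covering

end

theorem corollary2p3 {C : Type u} [Field C] [IsAlgClosed C] (ι : C →+* ℂ) :
    -- every covering has a finite exceptional set
    (∀ (K : Type v) [Field K] [Algebra (RatFunc C) K] [Algebra C K]
        [IsScalarTower C (RatFunc C) K] [FiniteDimensional (RatFunc C) K] [IsGalois (RatFunc C) K],
      ∃ S : Set (OnePoint C), S.Finite ∧ Covering.IsExceptionalSet.{u, v, w} ι K S) ∧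
    -- over a recursive algebraically closed field of constants (contained in `C`), an algorithm
    -- computes the list of the elements of such a set from an equation of the covering
    (∀ (k : Type) [Field k] [IsAlgClosed k] [Algebra k C] [Primcodable k],
      Computable₂ (fun a b : k => a + b) → Computable₂ (fun a b : k => a * b) →
      ∃ alg : List (List k) →. List (Option k), Partrec alg ∧
        ∀ (K : Type v) [Field K] [Algebra (RatFunc C) K] [Algebra C K]
          [IsScalarTower C (RatFunc C) K] [FiniteDimensional (RatFunc C) K]
          [IsGalois (RatFunc C) K] (F : List (List k)),
          Covering.IsEquation (C := C) (K := K) (Covering.ofCoeffs₂ F) →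
          ∃ L ∈ alg F,
            Covering.IsExceptionalSet.{u, v, w} ι K {q | ∃ c ∈ L, Covering.toLine c = q}) := by
  refine ⟨fun K _ _ _ _ _ _ => ?_, fun k _ _ _ _ hadd hmul => ?_⟩
  · obtain ⟨F, hF⟩ := Covering.exists_isEquation C K
    obtain ⟨L, hL⟩ := hF.exists_controlsFibres
    exact ⟨_, (List.finite_toSet (none :: L.map some)).image Covering.toLine,
      hL.isExceptionalSet ι hF⟩
  · let P := Covering.RingPresentation.ofField hadd hmul
    refine ⟨P.search, P.partrec_search, fun K _ _ _ _ _ _ F hF => ?_⟩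
    have hval : ∀ l : List k, P.listVal l = Covering.ofCoeffs l := fun l =>
      congrArg Covering.ofCoeffs (List.map_id l)
    have hPF : P.list.listVal F = Covering.ofCoeffs₂ F :=
      congrArg Covering.ofCoeffs (List.map_congr_left fun l _ => hval l)
    obtain ⟨L, hL⟩ := hF.exists_controlsFibres
    rw [← hPF] at hF hL
    obtain ⟨l, hl, hl'⟩ := P.exists_mem_search hL
    rw [show l.map P.val = l from List.map_id l] at hl'
    exact ⟨_, hl, hl'.isExceptionalSet ι hF⟩
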